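/- Let $(L,\mathrm{val})$ be a valued field with value group $\Gamma(L)$ such that $L$ is algebraically closed, and let $K\subseteq L$ be a subfield with the restricted valuation and value group $\Gamma(K)=\mathrm{val}(K^{\times})\subseteq\Gamma(L)$. A tuple $(a_i)_i$ in $L$ is called $K$-separated if $\mathrm{val}(\sum_i\lambda_i a_i)=\min_i \mathrm{val}(\lambda_i a_i)$ for every tuple $(\lambda_i)_i$ in $K$, and the pair $K\subseteq L$ is called separated if every finite-dimensional $K$-subspace of $L$ has a $K$-separated basis. For a structure $M$ and a subset $A\subseteq M$, write $\phi(A,b)$ for the set of tuples $x$ from $A$ such that $M\models\phi(x,b)$. The set $A$ is stably embedded in $M$ if for every formula $\phi(x;t)$ and every tuple $b$ in $M$ there are a formula $\chi(x;s)$ and a tuple $a$ in $A$ with $\phi(A,b)=\chi(A,a)$. It is uniformly stably embedded in $M$ if $\chi$ can be chosen depending only on $\phi$: for every formula $\phi(x;t)$ there is a formula $\chi(x;s)$ such that for every tuple $b$ in $M$ there is a tuple $a$ in $A$ with $\phi(A,b)=\chi(A,a)$. Valued fields are considered as structures in the two-sorted language, with a sort for the field with its ring structure, a sort for the ordered abelian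 value group together with $\infty$, and a symbol for the valuation; $K$ is considered as the subset $K\cup\Gamma(K)\cup\{\infty\}$ of the two-sorted structure $L$. Value groups are considered as structures in the language of ordered abelian groups. **Theorem.** Assume that the pair $K\subseteq L$ is separated and that $L$ is algebraically closed. Then $K$ is stably embedded in $L$ (as valued fields) if and only if $\Gamma(K)$ is stably embedded in $\Gamma(L)$ (as ordered abelian groups). Moreover, if $\Gamma(K)$ is uniformly stably embedded in $\Gamma(L)$, then $K$ is uniformly stably embedded in $L$. -/

import Mathlib

/-! ### Stable embeddedness -/

/-- A subset `A` of an `𝓛`-structure `M` is stably embedded if every set definable in `M` with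
parameters from `M` has the same trace on (the powers of) `A` as some set definable in `M` with
parameters from `A`. -/
def StablyEmbedded (𝓛 : FirstOrder.Language.{0, 0}) {M : Type*} [𝓛.Structure M] (A : Set M) : Prop :=
  ∀ (n : ℕ) (X : Set (Fin n → M)), (Set.univ : Set M).Definable 𝓛 X →
    ∃ Y : Set (Fin n → M), A.Definable 𝓛 Y ∧
      X ∩ {x | ∀ i, x i ∈ A} = Y ∩ {x | ∀ i, x i ∈ A}

/-- A subset `A` of an `𝓛`-structure `M` is uniformly stably embedded if for every formula
`φ(x; t)` there is a formula `χ(x; s)` such that for every tuple `b` in `M` there is a tuple `a`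
in `A` with `φ(A; b) = χ(A; a)`. -/
def UniformlyStablyEmbedded (𝓛 : FirstOrder.Language.{0, 0}) {M : Type*} [𝓛.Structure M] (A : Set M) :
    Prop :=
  ∀ (n m : ℕ) (φ : 𝓛.Formula (Fin n ⊕ Fin m)),
    ∃ (k : ℕ) (χ : 𝓛.Formula (Fin n ⊕ Fin k)), ∀ b : Fin m → M,
      ∃ a : Fin k → M, (∀ j, a j ∈ A) ∧
        {x : Fin n → M | (∀ i, x i ∈ A) ∧ φ.Realize (Sum.elim x b)} =
          {x : Fin n → M | (∀ i, x i ∈ A) ∧ χ.Realize (Sum.elim x a)}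

/-! ### The language of ordered abelian groups -/

/-- Function symbols `0`, `-`, `+`. -/
inductive OrderedGroupFunc : ℕ → Type
  | zero : OrderedGroupFunc 0
  | neg : OrderedGroupFunc 1
  | add : OrderedGroupFunc 2

/-- The relation symbol `≤`. -/
inductive OrderedGroupRel : ℕ → Type
  | le : OrderedGroupRel 2

/-- The language `{0, -, +, ≤}` of ordered abelian groups. -/
def orderedGroupLanguage : FirstOrder.Language.{0, 0} where
  Functions := OrderedGroupFunc
  Relations := OrderedGroupRel

/-- An ordered abelian group as a first-order structure. -/
instance orderedGroupStructure {Γ : Type*} [AddCommGroup Γ] [LinearOrder Γ] :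
    orderedGroupLanguage.Structure Γ where
  funMap := fun f x => match f with
    | OrderedGroupFunc.zero => 0
    | OrderedGroupFunc.neg => - x 0
    | OrderedGroupFunc.add => x 0 + x 1
  RelMap := fun r x => match r with
    | OrderedGroupRel.le => x 0 ≤ x 1

/-! ### The two-sorted language of valued fields

The sorts are the field `L` and `Γ ∪ {∞}`. A two-sorted structure is presented as the disjoint
union of its sorts, with a predicate for each sort and, for each function symbol, a relation symbol
for its graph; this does not change the definable sets. -/

/-- The symbols of the two-sorted language of valued fields. -/
inductive ValuedFieldRel : ℕ → Type
  | fieldSort : ValuedFieldRel 1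
  | valueSort : ValuedFieldRel 1
  | fieldZero : ValuedFieldRel 1
  | fieldOne : ValuedFieldRel 1
  | fieldNeg : ValuedFieldRel 2
  | fieldAdd : ValuedFieldRel 3
  | fieldMul : ValuedFieldRel 3
  | valueZero : ValuedFieldRel 1
  | valueTop : ValuedFieldRel 1
  | valueNeg : ValuedFieldRel 2
  | valueAdd : ValuedFieldRel 3
  | valueLE : ValuedFieldRel 2
  | val : ValuedFieldRel 2

/-- The two-sorted language of valued fields. -/
def valuedFieldLanguage : FirstOrder.Language.{0, 0} where
  Functions := fun _ => Empty
  Relations := ValuedFieldRel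

section ValuedField

variable {L : Type*} [Field L] {Γ : Type*} [AddCommGroup Γ] [LinearOrder Γ]
  [IsOrderedAddMonoid Γ]

/-- The disjoint union of the two sorts of the valued field `(L, val)`. -/
def TwoSorted (_val : AddValuation L (WithTop Γ)) := L ⊕ WithTop Γ

/-- An element of the field sort. -/
def TwoSorted.ofField (val : AddValuation L (WithTop Γ)) (x : L) : TwoSorted val := Sum.inl x

/-- An element of the value sort. -/
def TwoSorted.ofValue (val : AddValuation L (WithTop Γ)) (γ : WithTop Γ) : TwoSorted val :=
  Sum.inr γ

open TwoSorted in
/-- A valued field as a two-sorted structure. -/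
instance valuedFieldStructure (val : AddValuation L (WithTop Γ)) :
    valuedFieldLanguage.Structure (TwoSorted val) where
  funMap := fun f _ => nomatch f
  RelMap := fun r x => match r with
    | ValuedFieldRel.fieldSort => ∃ a : L, x 0 = ofField val a
    | ValuedFieldRel.valueSort => ∃ γ : WithTop Γ, x 0 = ofValue val γ
    | ValuedFieldRel.fieldZero => x 0 = ofField val 0
    | ValuedFieldRel.fieldOne => x 0 = ofField val 1
    | ValuedFieldRel.fieldNeg => ∃ a : L, x 0 = ofField val a ∧ x 1 = ofField val (-a)
    | ValuedFieldRel.fieldAdd =>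
        ∃ a b : L, x 0 = ofField val a ∧ x 1 = ofField val b ∧ x 2 = ofField val (a + b)
    | ValuedFieldRel.fieldMul =>
        ∃ a b : L, x 0 = ofField val a ∧ x 1 = ofField val b ∧ x 2 = ofField val (a * b)
    | ValuedFieldRel.valueZero => x 0 = ofValue val 0
    | ValuedFieldRel.valueTop => x 0 = ofValue val ⊤
    | ValuedFieldRel.valueNeg =>
        ∃ γ : Γ, x 0 = ofValue val γ ∧ x 1 = ofValue val ((-γ : Γ) : WithTop Γ)
    | ValuedFieldRel.valueAdd => ∃ γ δ : WithTop Γ,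
        x 0 = ofValue val γ ∧ x 1 = ofValue val δ ∧ x 2 = ofValue val (γ + δ)
    | ValuedFieldRel.valueLE =>
        ∃ γ δ : WithTop Γ, x 0 = ofValue val γ ∧ x 1 = ofValue val δ ∧ γ ≤ δ
    | ValuedFieldRel.val => ∃ a : L, x 0 = ofField val a ∧ x 1 = ofValue val (val a)

/-- The valued subfield `K` as a subset of the two-sorted structure of `L`: the elements of `K`
together with the values of elements of `K`. -/
def valuedSubfield (val : AddValuation L (WithTop Γ)) (K : Subfield L) : Set (TwoSorted val) :=
  (TwoSorted.ofField val '' {x | x ∈ K}) ∪ ((fun x => TwoSorted.ofValue val (val x)) '' {x | x ∈ K})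

/-- The value group of the valued subfield `K`, as a subset of `Γ`. -/
def valueGroupOf (val : AddValuation L (WithTop Γ)) (K : Subfield L) : Set Γ :=
  {γ | ∃ x ∈ K, val x = (γ : WithTop Γ)}

/-- A tuple `a` in `L` is `K`-separated if `val (∑ᵢ cᵢ aᵢ) = minᵢ val (cᵢ aᵢ)` for all tuples `c`
in `K`. -/
def IsSeparatedTuple (val : AddValuation L (WithTop Γ)) (K : Subfield L) {n : ℕ}
    (a : Fin n → L) : Prop :=
  ∀ c : Fin n → K,
    val (∑ i, (c i : L) * a i) = Finset.univ.inf fun i => val ((c i : L) * a i)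

/-- The pair `K ⊆ L` is separated if every finite-dimensional `K`-subspace of `L` has a
`K`-separated basis. -/
def IsSeparatedPair (val : AddValuation L (WithTop Γ)) (K : Subfield L) : Prop :=
  ∀ V : Submodule K L, FiniteDimensional K V →
    ∃ (n : ℕ) (b : Module.Basis (Fin n) K V), IsSeparatedTuple val K fun i => (b i : L)

end ValuedField

/-! The engine is quantifier elimination relative to the value group (`definableOver_of_definable`,
with converse `definable_of_definableOver`): over an algebraically closed valued field, a set is
∅-definable exactly when it is a definable condition in Γ ∪ {∞} on finitely many values val p(x),
with p an integer polynomial in the field coordinates, together with the value coordinates and codes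
for the sorts.

To eliminate a field quantifier over x (`definableOver_exists_field`), let α be nearest to x among
the roots of X and of the nonzero q_i occurring in the formula. Then val q_i(x) is the minimum over
k of val (D_k q_i)(α) + k val(x - α), with D_k the Hasse derivatives
(`val_eval_le_of_nearest_root`). Conversely, for any centre α and any prescribed value of x - α, a
generic x realises these minima (`exists_generic`). What remains is which tuples of values val
s_j(α) occur at roots α of a polynomial q. Products of powers of the s_j reduce this to one value at
a time (`exists_eq_of_forall_weight`), a resultant produces a polynomial whose roots are those
products evaluated at the α (`exists_norm`), and its Newton polygon reads off the values of its
roots (`exists_root_val_eq_iff`).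

Separatedness then isolates the parameters. For x in K, expand the monomials in the parameters b
along a K-separated family e_h: val p(x, b) becomes the minimum of val r_h(x, k) + val e_h, with k
in K (`IsSeparatedPair.exists_normal_form`). The tuple x enters only through Γ(K) ∪ {∞}, and what
lies outside K enters only through the values val e_h, so embeddedness of Γ(K) in Γ(L) replaces
these by parameters from K. Conversely, on tuples of values every basic function with parameters in
K is a coordinate or a constant of Γ(K) ∪ {∞}, so K induces nothing new on Γ(K).

`FamilyEmbedded` treats both versions at once: a one-element index type gives stable embeddedness,
and the type of all parameter tuples gives the uniform notion. -/

open FirstOrder FirstOrder.Language Set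

/-! ### Definable sets in relational languages -/

/-- Induction principle for the `∅`-definable sets of a structure in a relational language. -/
theorem definable_induction_of_relational {𝓛 : FirstOrder.Language.{0, 0}}
    [∀ n, IsEmpty (𝓛.Functions n)] {M : Type*} [𝓛.Structure M]
    (P : ∀ {α : Type}, Set (α → M) → Prop)
    (hrel : ∀ {α : Type} {n : ℕ} (R : 𝓛.Relations n) (f : Fin n → α),
      P {x : α → M | Structure.RelMap R (x ∘ f)})
    (heq : ∀ {α : Type} (i j : α), P {x : α → M | x i = x j})
    (hempty : ∀ {α : Type}, P (∅ : Set (α → M)))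
    (himp : ∀ {α : Type} {S T : Set (α → M)}, P S → P T → P (Sᶜ ∪ T))
    (hall : ∀ {α : Type} {S : Set (Option α → M)}, P S →
      P {x : α → M | ∀ m, (fun o : Option α => o.elim m x) ∈ S})
    (hcomp : ∀ {α β : Type} (f : α → β) {S : Set (α → M)}, P S → P {x : β → M | x ∘ f ∈ S})
    {α : Type} {S : Set (α → M)} (hS : (∅ : Set M).Definable 𝓛 S) : P S := by
  have hvar : ∀ {β : Type} (t : 𝓛.Term β), ∃ i, t = Term.var i := by
    intro β t
    cases t with
    | var i => exact ⟨i, rfl⟩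
    | func f _ => exact isEmptyElim f
  have key : ∀ {n : ℕ} (φ : 𝓛.BoundedFormula α n),
      P {z : α ⊕ Fin n → M | φ.Realize (z ∘ Sum.inl) (z ∘ Sum.inr)} := by
    intro n φ
    induction φ with
    | falsum => simpa [BoundedFormula.Realize] using! hempty
    | equal t₁ t₂ =>
      obtain ⟨i, rfl⟩ := hvar t₁
      obtain ⟨j, rfl⟩ := hvar t₂
      simpa [BoundedFormula.Realize] using! heq i j
    | rel R ts =>
      choose f hf using fun i => hvar (ts i)
      obtain rfl : ts = fun i => Term.var (f i) := funext hf
      convert! hrel R f using 1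
      ext z
      rw [mem_ofPred_eq, mem_ofPred_eq]
      change Structure.RelMap R (fun i => Sum.elim (z ∘ Sum.inl) (z ∘ Sum.inr) (f i)) ↔ _
      rw [Sum.elim_comp_inl_inr]
      rfl
    | imp φ ψ h₁ h₂ =>
      convert! himp h₁ h₂ using 1
      ext z
      simp only [BoundedFormula.realize_imp, mem_ofPred_eq, mem_union, mem_compl_iff]
      tauto
    | @all n φ h =>
      -- The last bound variable goes to `none`, the slot quantified in `hall`.
      let f : α ⊕ Fin (n + 1) → Option (α ⊕ Fin n) :=
        Sum.elim (fun a => some (Sum.inl a)) (Fin.snoc (fun i => some (Sum.inr i)) none)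
      convert! hall (hcomp f h) using 1
      ext z
      simp only [BoundedFormula.realize_all, mem_ofPred_eq]
      refine forall_congr' fun m => ?_
      have h₁ : ((fun o : Option (α ⊕ Fin n) => o.elim m z) ∘ f) ∘ Sum.inl = z ∘ Sum.inl := by
        ext i; simp [f]
      have h₂ : ((fun o : Option (α ⊕ Fin n) => o.elim m z) ∘ f) ∘ Sum.inr
          = Fin.snoc (z ∘ Sum.inr) m := by
        ext i
        refine Fin.lastCases ?_ (fun i => ?_) i <;> simp [f]
      rw [h₁, h₂]
  obtain ⟨φ, rfl⟩ := empty_definable_iff.1 hS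
  convert! hcomp (Sum.elim id finZeroElim : α ⊕ Fin 0 → α) (key φ) using 1
  ext x
  simp only [mem_ofPred_eq, Formula.Realize]
  rw [iff_iff_eq]
  congr 1
  exact Subsingleton.elim _ _

theorem Set.Definable.forall_option {𝓛 : FirstOrder.Language.{0, 0}} {M : Type*} [𝓛.Structure M]
    {A : Set M} {α : Type} {S : Set (Option α → M)} (hS : A.Definable 𝓛 S) :
    A.Definable 𝓛 {x : α → M | ∀ m, (fun o : Option α => o.elim m x) ∈ S} := by
  have := (hS.preimage_comp (fun o : Option α => o.elim (Sum.inr ()) Sum.inl :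
    Option α → α ⊕ Unit)).forall_of_finite
  convert! this using 1
  ext x
  simp only [mem_ofPred_eq, mem_preimage]
  constructor
  · intro h u
    convert h (u ()) using 1
    ext o; cases o <;> rfl
  · intro h m
    convert h (fun _ => m) using 1
    ext o; cases o <;> rfl

/-! ### The value group with infinity -/

/-- Relation symbols `0`, `∞`, `+` and `≤` for an ordered abelian group with `∞`. -/
inductive ExtendedGroupRel : ℕ → Type
  | zero : ExtendedGroupRel 1
  | top : ExtendedGroupRel 1
  | add : ExtendedGroupRel 3
  | le : ExtendedGroupRel 2

/-- The relational language of ordered abelian groups with `∞`. -/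
def extendedGroupLanguage : FirstOrder.Language.{0, 0} where
  Functions := fun _ => Empty
  Relations := ExtendedGroupRel

instance (n : ℕ) : IsEmpty (extendedGroupLanguage.Functions n) := inferInstanceAs (IsEmpty Empty)

instance (n : ℕ) : IsEmpty (valuedFieldLanguage.Functions n) := inferInstanceAs (IsEmpty Empty)

section Extended

set_option linter.unusedSectionVars false

variable {Γ : Type*} [AddCommGroup Γ] [LinearOrder Γ] [IsOrderedAddMonoid Γ]

instance extendedGroupStructure : extendedGroupLanguage.Structure (WithTop Γ) where
  funMap := fun f _ => nomatch f
  RelMap := fun r x => match r with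
    | ExtendedGroupRel.zero => x 0 = 0
    | ExtendedGroupRel.top => x 0 = ⊤
    | ExtendedGroupRel.add => x 0 + x 1 = x 2
    | ExtendedGroupRel.le => x 0 ≤ x 1

/-- `∅`-definable sets of tuples in the value group with `∞`. -/
abbrev ValueDefinable {α : Type} (S : Set (α → WithTop Γ)) : Prop :=
  (∅ : Set (WithTop Γ)).Definable extendedGroupLanguage S

/-- `∅`-definable functions on the value group with `∞`. -/
abbrev ValueDefinableFun {α : Type} (f : (α → WithTop Γ) → WithTop Γ) : Prop :=
  (∅ : Set (WithTop Γ)).DefinableFun extendedGroupLanguage f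

theorem valueDefinableFun_proj {α : Type} (i : α) :
    ValueDefinableFun (fun x : α → WithTop Γ => x i) := DefinableFun.proj _

theorem valueDefinable_rel {α : Type} {n : ℕ} (R : extendedGroupLanguage.Relations n)
    (f : Fin n → α) : ValueDefinable {x : α → WithTop Γ | Structure.RelMap R (x ∘ f)} := by
  refine empty_definable_iff.2 ⟨R.formula fun i => Term.var (f i), ?_⟩
  ext x
  simp [Formula.realize_rel, Function.comp_def]

theorem valueDefinableFun_zero {α : Type} :
    ValueDefinableFun (fun _ : α → WithTop Γ => 0) := by
  have h : (fun _ : α → WithTop Γ => (0 : WithTop Γ)).tupleGraph =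
      {x | Structure.RelMap (L := extendedGroupLanguage) ExtendedGroupRel.zero (x ∘ ![none])} :=
    Set.ext fun x => eq_comm
  rw [ValueDefinableFun, DefinableFun, h]
  exact valueDefinable_rel _ _

theorem valueDefinableFun_top {α : Type} :
    ValueDefinableFun (fun _ : α → WithTop Γ => ⊤) := by
  have h : (fun _ : α → WithTop Γ => (⊤ : WithTop Γ)).tupleGraph =
      {x | Structure.RelMap (L := extendedGroupLanguage) ExtendedGroupRel.top (x ∘ ![none])} :=
    Set.ext fun x => eq_comm
  rw [ValueDefinableFun, DefinableFun, h]
  exact valueDefinable_rel _ _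

theorem valueDefinable_le {α : Type} (i j : α) :
    ValueDefinable {x : α → WithTop Γ | x i ≤ x j} :=
  valueDefinable_rel ExtendedGroupRel.le ![i, j]

theorem valueDefinableFun_add {α : Type} (i j : α) :
    ValueDefinableFun (fun x : α → WithTop Γ => x i + x j) := by
  convert! valueDefinable_rel (Γ := Γ) ExtendedGroupRel.add ![some i, some j, none] using 1

theorem valueDefinable_eq {α : Type} {f g : (α → WithTop Γ) → WithTop Γ}
    (hf : ValueDefinableFun f) (hg : ValueDefinableFun g) :
    ValueDefinable {x : α → WithTop Γ | f x = g x} := hf.ofPred_eq hg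

theorem valueDefinable_le' {α : Type} {f g : (α → WithTop Γ) → WithTop Γ}
    (hf : ValueDefinableFun f) (hg : ValueDefinableFun g) :
    ValueDefinable {x : α → WithTop Γ | f x ≤ g x} := by
  have hF : (∅ : Set (WithTop Γ)).DefinableMap extendedGroupLanguage
      (fun v : α → WithTop Γ => ![f v, g v]) := by
    simp [DefinableMap, *]
  exact (valueDefinable_le (Γ := Γ) (0 : Fin 2) 1).preimage_map hF

theorem ValueDefinableFun.add {α : Type} {f g : (α → WithTop Γ) → WithTop Γ}
    (hf : ValueDefinableFun f) (hg : ValueDefinableFun g) :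
    ValueDefinableFun (fun x => f x + g x) := by
  have hF : (∅ : Set (WithTop Γ)).DefinableMap extendedGroupLanguage
      (fun v : α → WithTop Γ => ![f v, g v]) := by
    simp [DefinableMap, *]
  exact DefinableFun.comp hF (valueDefinableFun_add (0 : Fin 2) 1)

theorem ValueDefinableFun.nsmul {α : Type} {f : (α → WithTop Γ) → WithTop Γ}
    (hf : ValueDefinableFun f) (n : ℕ) : ValueDefinableFun (fun x => n • f x) := by
  induction n with
  | zero => simpa using valueDefinableFun_zero
  | succ n ih => simpa only [succ_nsmul] using! ih.add hf

open Classical in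
theorem ValueDefinableFun.inf {α : Type} {f g : (α → WithTop Γ) → WithTop Γ}
    (hf : ValueDefinableFun f) (hg : ValueDefinableFun g) :
    ValueDefinableFun (fun x => f x ⊓ g x) := by
  have := DefinableFun.ite (valueDefinable_le' hf hg) hf hg
  convert! this using 2 with x
  split_ifs with h
  · exact inf_eq_left.2 h
  · exact inf_eq_right.2 (le_of_not_ge h)

theorem ValueDefinableFun.finset_inf {α ι : Type} (s : Finset ι)
    {f : ι → (α → WithTop Γ) → WithTop Γ}
    (hf : ∀ i, ValueDefinableFun (f i)) : ValueDefinableFun (fun x => s.inf fun i => f i x) := by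
  classical
  induction s using Finset.induction_on with
  | empty => simpa using valueDefinableFun_top
  | insert i s hi ih => simpa only [Finset.inf_insert] using! (hf i).inf ih

end Extended

/-! ### Sets definable from a family of value-group-valued functions -/

section BasicDefinable

set_option linter.unusedSectionVars false

variable {Γ : Type*} [AddCommGroup Γ] [LinearOrder Γ] [IsOrderedAddMonoid Γ]
  {E : Type*} {E' : Type*}

/-- A set is definable over a family `𝓕` of functions with values in the value group with `∞` if
membership is a definable condition on finitely many members of `𝓕`. -/
def DefinableOver (𝓕 : Set (E → WithTop Γ)) (D : Set E) : Prop :=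
  ∃ (ι : Type) (_ : Finite ι) (f : ι → E → WithTop Γ) (S : Set (ι → WithTop Γ)),
    (∀ i, f i ∈ 𝓕) ∧ ValueDefinable S ∧ D = {e | (fun i => f i e) ∈ S}

/-- A function is definable over `𝓕` if it is a definable function of finitely many members
of `𝓕`. -/
def DefinableFunOver (𝓕 : Set (E → WithTop Γ)) (h : E → WithTop Γ) : Prop :=
  ∃ (ι : Type) (_ : Finite ι) (f : ι → E → WithTop Γ) (F : (ι → WithTop Γ) → WithTop Γ),
    (∀ i, f i ∈ 𝓕) ∧ ValueDefinableFun F ∧ h = fun e => F fun i => f i e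

variable {𝓕 : Set (E → WithTop Γ)}

theorem DefinableFunOver.of_mem {f : E → WithTop Γ} (hf : f ∈ 𝓕) : DefinableFunOver 𝓕 f :=
  ⟨Unit, inferInstance, fun _ => f, fun x => x (), fun _ => hf, valueDefinableFun_proj _, rfl⟩

theorem ValueDefinableFun.comp_left {α β : Type} {F : (α → WithTop Γ) → WithTop Γ}
    (hF : ValueDefinableFun F) (k : α → β) :
    ValueDefinableFun (fun x : β → WithTop Γ => F fun a => x (k a)) := by
  have : (fun x : β → WithTop Γ => F fun a => x (k a)).tupleGraph =
      (fun g : Option β → WithTop Γ => g ∘ Option.map k) ⁻¹' F.tupleGraph := rfl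
  rw [ValueDefinableFun, DefinableFun, this]
  exact Definable.preimage_comp _ hF

/-- Each `h k` uses its own finite subfamily of `𝓕`; the sigma type of their index types serves all
of them at once. -/
theorem DefinableOver.subst {κ : Type} [Finite κ] {h : κ → E → WithTop Γ}
    (hh : ∀ k, DefinableFunOver 𝓕 (h k)) {S : Set (κ → WithTop Γ)} (hS : ValueDefinable S) :
    DefinableOver 𝓕 {e | (fun k => h k e) ∈ S} := by
  choose ι hι f F hf hF hfF using hh
  refine ⟨Σ k, ι k, inferInstance, fun i => f i.1 i.2,
    (fun (x : (Σ k, ι k) → WithTop Γ) k => F k fun i => x ⟨k, i⟩) ⁻¹' S, fun i => hf _ _, ?_, ?_⟩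
  · exact hS.preimage_map (F := fun (x : (Σ k, ι k) → WithTop Γ) k => F k fun i => x ⟨k, i⟩)
      fun k => (hF k).comp_left (fun i => (⟨k, i⟩ : Σ k, ι k))
  · ext e
    simp [hfF]

theorem DefinableFunOver.subst {κ : Type} [Finite κ] {h : κ → E → WithTop Γ}
    (hh : ∀ k, DefinableFunOver 𝓕 (h k)) {G : (κ → WithTop Γ) → WithTop Γ}
    (hG : ValueDefinableFun G) : DefinableFunOver 𝓕 (fun e => G fun k => h k e) := by
  choose ι hι f F hf hF hfF using hh
  refine ⟨Σ k, ι k, inferInstance, fun i => f i.1 i.2, fun x => G fun k => F k fun i => x ⟨k, i⟩,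
    fun i => hf _ _, ?_, ?_⟩
  · exact DefinableFun.comp (g := fun (x : (Σ k, ι k) → WithTop Γ) k => F k fun i => x ⟨k, i⟩)
      (fun k => (hF k).comp_left (fun i => (⟨k, i⟩ : Σ k, ι k))) hG
  · ext e
    simp [hfF]

theorem DefinableFunOver.trans {𝓖 : Set (E' → WithTop Γ)} {k : E → E'}
    (hk : ∀ g ∈ 𝓖, DefinableFunOver 𝓕 (g ∘ k)) {h : E' → WithTop Γ}
    (hh : DefinableFunOver 𝓖 h) : DefinableFunOver 𝓕 (h ∘ k) := by
  obtain ⟨ι, _, f, F, hf, hF, rfl⟩ := hh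
  exact .subst (fun i => hk _ (hf i)) hF

theorem DefinableOver.preimage {𝓖 : Set (E' → WithTop Γ)} {k : E → E'}
    (hk : ∀ g ∈ 𝓖, DefinableFunOver 𝓕 (g ∘ k)) {D : Set E'}
    (hD : DefinableOver 𝓖 D) : DefinableOver 𝓕 (k ⁻¹' D) := by
  obtain ⟨ι, _, f, S, hf, hS, rfl⟩ := hD
  exact .subst (fun i => hk _ (hf i)) hS

theorem DefinableOver.compl {D : Set E} (hD : DefinableOver 𝓕 D) : DefinableOver 𝓕 Dᶜ := by
  obtain ⟨ι, hι, f, S, hf, hS, rfl⟩ := hD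
  exact ⟨ι, hι, f, Sᶜ, hf, hS.compl, rfl⟩

theorem DefinableOver.inter {D D' : Set E} (hD : DefinableOver 𝓕 D) (hD' : DefinableOver 𝓕 D') :
    DefinableOver 𝓕 (D ∩ D') := by
  obtain ⟨ι, hι, f, S, hf, hS, rfl⟩ := hD
  obtain ⟨ι', hι', f', S', hf', hS', rfl⟩ := hD'
  exact ⟨ι ⊕ ι', inferInstance, Sum.elim f f', _, by rintro (i | i) <;> simp [hf, hf'],
    (hS.preimage_comp Sum.inl).inter (hS'.preimage_comp Sum.inr), rfl⟩

theorem DefinableOver.union {D D' : Set E} (hD : DefinableOver 𝓕 D) (hD' : DefinableOver 𝓕 D') :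
    DefinableOver 𝓕 (D ∪ D') := by
  have := (hD.compl.inter hD'.compl).compl
  rwa [compl_inter, compl_compl, compl_compl] at this

theorem DefinableOver.empty : DefinableOver 𝓕 ∅ :=
  ⟨Empty, inferInstance, fun i => i.elim, ∅, fun i => i.elim, definable_empty, rfl⟩

theorem DefinableOver.univ : DefinableOver 𝓕 Set.univ :=
  ⟨Empty, inferInstance, fun i => i.elim, Set.univ, fun i => i.elim, definable_univ, rfl⟩

theorem DefinableOver.const (p : Prop) : DefinableOver 𝓕 {_e | p} := by
  by_cases h : p
  · simpa [h] using! DefinableOver.univ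
  · simpa [h] using! DefinableOver.empty

theorem DefinableOver.iUnion {ι : Type*} [Finite ι] {D : ι → Set E}
    (hD : ∀ i, DefinableOver 𝓕 (D i)) : DefinableOver 𝓕 (⋃ i, D i) := by
  classical
  have := Fintype.ofFinite ι
  suffices h : ∀ s : Finset ι, DefinableOver 𝓕 (⋃ i ∈ s, D i) by simpa using h Finset.univ
  intro s
  induction s using Finset.induction_on with
  | empty => simpa using DefinableOver.empty
  | insert i s hi ih => simpa [Finset.set_biUnion_insert] using (hD i).union ih

theorem DefinableOver.iInter {ι : Type*} [Finite ι] {D : ι → Set E}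
    (hD : ∀ i, DefinableOver 𝓕 (D i)) : DefinableOver 𝓕 (⋂ i, D i) := by
  have := (DefinableOver.iUnion fun i => (hD i).compl).compl
  rwa [compl_iUnion, iInter_congr fun i => compl_compl (D i)] at this

theorem DefinableOver.and {p q : E → Prop} (hp : DefinableOver 𝓕 {e | p e})
    (hq : DefinableOver 𝓕 {e | q e}) : DefinableOver 𝓕 {e | p e ∧ q e} := hp.inter hq

theorem DefinableOver.not {p : E → Prop} (hp : DefinableOver 𝓕 {e | p e}) :
    DefinableOver 𝓕 {e | ¬ p e} := hp.compl

theorem DefinableOver.imp {p q : E → Prop} (hp : DefinableOver 𝓕 {e | p e})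
    (hq : DefinableOver 𝓕 {e | q e}) : DefinableOver 𝓕 {e | p e → q e} := by
  simpa only [imp_iff_not_or] using! hp.compl.union hq

theorem DefinableOver.iff {p q : E → Prop} (hp : DefinableOver 𝓕 {e | p e})
    (hq : DefinableOver 𝓕 {e | q e}) : DefinableOver 𝓕 {e | p e ↔ q e} := by
  simpa only [iff_iff_implies_and_implies] using! (hp.imp hq).and (hq.imp hp)

theorem DefinableOver.forall {ι : Type*} [Finite ι] {p : ι → E → Prop}
    (hp : ∀ i, DefinableOver 𝓕 {e | p i e}) : DefinableOver 𝓕 {e | ∀ i, p i e} := by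
  simpa only [ofPred_forall] using! DefinableOver.iInter hp

theorem DefinableOver.exists {ι : Type*} [Finite ι] {p : ι → E → Prop}
    (hp : ∀ i, DefinableOver 𝓕 {e | p i e}) : DefinableOver 𝓕 {e | ∃ i, p i e} := by
  simpa only [ofPred_exists] using! DefinableOver.iUnion hp

theorem DefinableOver.congr {D D' : Set E} (hD : DefinableOver 𝓕 D)
    (h : ∀ e, e ∈ D' ↔ e ∈ D) : DefinableOver 𝓕 D' := by
  rwa [Set.ext h]

theorem DefinableOver.eq {f g : E → WithTop Γ} (hf : DefinableFunOver 𝓕 f)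
    (hg : DefinableFunOver 𝓕 g) : DefinableOver 𝓕 {e | f e = g e} :=
  .subst (κ := Bool) (h := fun b => if b then f else g) (by simp [hf, hg])
    (valueDefinable_eq (f := fun x : Bool → WithTop Γ => x true) (g := fun x => x false)
      (valueDefinableFun_proj _) (valueDefinableFun_proj _))

theorem DefinableOver.le {f g : E → WithTop Γ} (hf : DefinableFunOver 𝓕 f)
    (hg : DefinableFunOver 𝓕 g) : DefinableOver 𝓕 {e | f e ≤ g e} :=
  .subst (κ := Bool) (h := fun b => if b then f else g) (by simp [hf, hg])
    (valueDefinable_le true false)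

theorem DefinableFunOver.zero : DefinableFunOver 𝓕 (fun _ => 0) :=
  .subst (κ := Empty) (h := fun i => i.elim) (fun i => i.elim) valueDefinableFun_zero

theorem DefinableFunOver.top : DefinableFunOver 𝓕 (fun _ => ⊤) :=
  .subst (κ := Empty) (h := fun i => i.elim) (fun i => i.elim) valueDefinableFun_top

theorem DefinableOver.eq_top {f : E → WithTop Γ} (hf : DefinableFunOver 𝓕 f) :
    DefinableOver 𝓕 {e | f e = ⊤} := .eq hf .top

theorem DefinableFunOver.add {f g : E → WithTop Γ} (hf : DefinableFunOver 𝓕 f)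
    (hg : DefinableFunOver 𝓕 g) : DefinableFunOver 𝓕 (fun e => f e + g e) :=
  .subst (κ := Bool) (h := fun b => if b then f else g) (by simp [hf, hg])
    (valueDefinableFun_add true false)

theorem DefinableFunOver.nsmul {f : E → WithTop Γ} (hf : DefinableFunOver 𝓕 f) (n : ℕ) :
    DefinableFunOver 𝓕 (fun e => n • f e) :=
  .subst (κ := Unit) (h := fun _ => f) (by simp [hf])
    (ValueDefinableFun.nsmul (f := fun x : Unit → WithTop Γ => x ()) (valueDefinableFun_proj _) n)

theorem DefinableFunOver.sum {ι : Type} {s : Finset ι} {f : ι → E → WithTop Γ}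
    (hf : ∀ i, DefinableFunOver 𝓕 (f i)) : DefinableFunOver 𝓕 (fun e => ∑ i ∈ s, f i e) := by
  classical
  induction s using Finset.induction_on with
  | empty => simpa using! DefinableFunOver.zero
  | insert i s hi ih => simpa only [Finset.sum_insert hi] using! (hf i).add ih

theorem DefinableFunOver.finset_inf {ι : Type} {s : Finset ι} {f : ι → E → WithTop Γ}
    (hf : ∀ i, DefinableFunOver 𝓕 (f i)) : DefinableFunOver 𝓕 (fun e => s.inf fun i => f i e) := by
  classical
  induction s using Finset.induction_on with
  | empty => simpa using! DefinableFunOver.top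
  | insert i s hi ih =>
    simp only [Finset.inf_insert]
    exact .subst (κ := Bool)
      (h := fun b => if b then f i else fun e => s.inf fun i => f i e) (by simp [hf, ih])
      (G := fun x => x true ⊓ x false) (.inf (valueDefinableFun_proj _) (valueDefinableFun_proj _))

/-- The family on `E × (κ → Γ ∪ {∞})` consisting of `𝓕` and the coordinate functions. -/
def withCoords (𝓕 : Set (E → WithTop Γ)) (κ : Type) : Set (E × (κ → WithTop Γ) → WithTop Γ) :=
  {f | (∃ g ∈ 𝓕, f = fun e => g e.1) ∨ ∃ k, f = fun e => e.2 k}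

/-- Quantifiers over values are absorbed into the condition on the value group: the functions used
are either independent of `w` or coordinates of `w`, and the condition is projected along the
latter. -/
theorem DefinableOver.exists_values {κ : Type} [Finite κ] {D : Set (E × (κ → WithTop Γ))}
    (hD : DefinableOver (withCoords 𝓕 κ) D) : DefinableOver 𝓕 {e | ∃ w, (e, w) ∈ D} := by
  classical
  obtain ⟨ι, _, f, S, hf, hS, rfl⟩ := hD
  let I := {i // ∃ g ∈ 𝓕, f i = fun e => g e.1}
  have hI : ∀ i : I, ∃ g ∈ 𝓕, f i.1 = fun e => g e.1 := fun i => i.2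
  choose g hg hgf using hI
  have hJ : ∀ i, ∃ c : I ⊕ κ, ∀ e, f i e = Sum.elim (fun i => g i e.1) e.2 c := by
    intro i
    by_cases h : ∃ g ∈ 𝓕, f i = fun e => g e.1
    · exact ⟨Sum.inl ⟨i, h⟩, fun e => by simpa using congrFun (hgf ⟨i, h⟩) e⟩
    · obtain ⟨k, hk⟩ := (hf i).resolve_left h
      exact ⟨Sum.inr k, fun e => by simp [hk]⟩
  choose c hc using hJ
  refine ⟨I, inferInstance, g, _, hg, (hS.preimage_comp c).exists_of_finite, ?_⟩
  ext e
  simp only [mem_ofPred_eq, mem_preimage]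
  refine exists_congr fun w => ?_
  simp only [hc]
  rfl

theorem DefinableFunOver.withCoords_fst {κ : Type} {f : E → WithTop Γ}
    (hf : DefinableFunOver 𝓕 f) : DefinableFunOver (withCoords 𝓕 κ) (fun e => f e.1) :=
  .trans (k := Prod.fst) (fun g hg => .of_mem (Or.inl ⟨g, hg, rfl⟩)) hf

theorem DefinableFunOver.withCoords_snd {κ : Type} (k : κ) :
    DefinableFunOver (withCoords 𝓕 κ) (fun e => e.2 k) :=
  .of_mem (Or.inr ⟨k, rfl⟩)

end BasicDefinable

/-! ### Values of polynomials over algebraically closed valued fields -/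

section Polynomials

open Polynomial

variable {L : Type*} [Field L] {Γ : Type*} [AddCommGroup Γ] [LinearOrder Γ]
  [IsOrderedAddMonoid Γ] (val : AddValuation L (WithTop Γ))

theorem AddValuation.map_prod_eq_sum {ι : Type*} (s : Finset ι) (f : ι → L) :
    val (∏ i ∈ s, f i) = ∑ i ∈ s, val (f i) := by
  classical
  induction s using Finset.induction_on with
  | empty => simp
  | insert i s hi ih => rw [Finset.prod_insert hi, Finset.sum_insert hi, val.map_mul, ih]

/-- Finitely many residue classes can be avoided: take a root u of ∏ (X - z) = 1. If val u were
negative, every factor u - z would have negative value; hence all factors have nonnegative values,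
and these sum to 0. -/
theorem exists_val_sub_eq_zero [IsAlgClosed L] (s : Finset L) (hs : ∀ z ∈ s, 0 ≤ val z) :
    ∃ u, 0 ≤ val u ∧ ∀ z ∈ s, val (u - z) = 0 := by
  classical
  rcases s.eq_empty_or_nonempty with rfl | ⟨z₀, hz₀⟩
  · exact ⟨0, by simp, by simp⟩
  have hdeg : (∏ z ∈ s, (X - C z)).natDegree = s.card := by
    simp
  obtain ⟨u, hu⟩ := IsAlgClosed.exists_root (∏ z ∈ s, (X - C z) - C 1) (by
    intro h
    have := natDegree_sub_C (p := ∏ z ∈ s, (X - C z)) (a := (1 : L))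
    rw [natDegree_eq_of_degree_eq_some h, hdeg] at this
    exact (Finset.card_pos.2 ⟨z₀, hz₀⟩).ne this)
  have hprod : ∏ z ∈ s, (u - z) = 1 := by
    simpa [IsRoot, eval_prod, sub_eq_zero] using hu
  have hsum : ∑ z ∈ s, val (u - z) = 0 := by
    rw [← val.map_prod_eq_sum, hprod, val.map_one]
  have hu0 : 0 ≤ val u := by
    by_contra! hlt
    have h1 : ∀ z ∈ s, val (u - z) < 0 := by
      intro z hz
      rw [val.map_sub_eq_of_lt_left (hlt.trans_le (hs z hz))]
      exact hlt
    have h2 : ∑ z ∈ s, val (u - z) ≤ ∑ z ∈ s.erase z₀, val (u - z) + val (u - z₀) := by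
      rw [Finset.sum_erase_add s _ hz₀]
    have h3 : ∑ z ∈ s.erase z₀, val (u - z) ≤ 0 :=
      Finset.sum_nonpos fun z hz => (h1 z (Finset.mem_of_mem_erase hz)).le
    have h4 := (h2.trans (add_le_add_left h3 _)).trans_lt (by simpa using h1 z₀ hz₀)
    exact h4.ne hsum
  refine ⟨u, hu0, fun z hz => ?_⟩
  exact (Finset.sum_eq_zero_iff_of_nonneg fun z hz => val.map_le_sub hu0 (hs z hz)).1 hsum z hz

theorem val_sum_eq_of_unique {ι : Type*} (s : Finset ι) (f : ι → L) {i : ι} (hi : i ∈ s)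
    (h : ∀ j ∈ s, j ≠ i → val (f i) < val (f j)) : val (∑ j ∈ s, f j) = val (f i) := by
  classical
  by_cases htop : val (f i) = ⊤
  · have : s = {i} := by
      refine Finset.eq_singleton_iff_unique_mem.2 ⟨hi, fun j hj => ?_⟩
      by_contra hne
      exact absurd (h j hj hne) (by simp [htop])
    simp [this]
  · rw [← Finset.add_sum_erase s f hi]
    refine val.map_add_eq_of_lt_left ?_
    exact val.map_lt_sum htop fun j hj =>
      h j (Finset.mem_of_mem_erase hj) (Finset.ne_of_mem_erase hj)

theorem le_val_eval {m : WithTop Γ} (f : L[X]) (x : L)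
    (h : ∀ k, m ≤ val (f.coeff k) + k • val x) : m ≤ val (f.eval x) := by
  rw [eval_eq_sum]
  refine val.map_le_sum fun k _ => ?_
  rw [val.map_mul, val.map_pow]
  exact h k

/-- One inequality is the ultrametric one, so "f takes its expected value at x" is expressed by the
upper bounds alone. Any `N` beyond the degree will do, since zero coefficients contribute ∞. -/
theorem val_eval_eq_inf {f : L[X]} {x : L} (h : ∀ k, val (f.eval x) ≤ val (f.coeff k) + k • val x)
    {N : ℕ} (hN : f.natDegree < N) :
    val (f.eval x) = (Finset.range N).inf fun k => val (f.coeff k) + k • val x := by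
  refine le_antisymm (Finset.le_inf fun k _ => h k) (le_val_eval val f x fun k => ?_)
  by_cases hk : k < N
  · exact Finset.inf_le (Finset.mem_range.2 hk)
  · rw [coeff_eq_zero_of_natDegree_lt (by omega)]
    simp

/-- Polynomials take the expected value at elements in generic residue classes. -/
theorem exists_val_eval_le_of_generic (f : L[X]) :
    ∃ F : Finset L, (∀ z ∈ F, 0 ≤ val z) ∧ ∀ u, 0 ≤ val u → (∀ z ∈ F, val (u - z) = 0) →
      ∀ k, val (f.eval u) ≤ val (f.coeff k) := by
  classical
  induction hn : f.natDegree using Nat.strong_induction_on generalizing f with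
  | _ n ih =>
    -- If an integral z makes the value too large, f = g (X - z) + f(z). The classes to avoid for f
    -- are those for g and that of z: at other points f has the value of g (u - z), because f(z) is
    -- negligible.
    by_cases hz : ∃ z, 0 ≤ val z ∧ ∃ k, val (f.coeff k) < val (f.eval z)
    swap
    · push Not at hz
      exact ⟨∅, by simp, fun u hu _ => hz u hu⟩
    obtain ⟨z, hz, k, hk⟩ := hz
    have hf0 : f ≠ 0 := by rintro rfl; simp at hk
    have hn0 : 0 < f.natDegree := by
      by_contra h0
      rw [eq_C_of_natDegree_eq_zero (by omega : f.natDegree = 0)] at hk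
      rcases k with _ | k
      · simp at hk
      · simp at hk
    obtain ⟨k₀, _, hk₀⟩ := f.support.exists_min_image (fun k => val (f.coeff k))
      (support_nonempty.2 hf0)
    have hmin : ∀ j, val (f.coeff k₀) ≤ val (f.coeff j) := by
      intro j
      by_cases hj : j ∈ f.support
      · exact hk₀ j hj
      · simp [notMem_support_iff.1 hj]
    have hlt : val (f.coeff k₀) < val (f.eval z) := (hmin k).trans_lt hk
    set g := f /ₘ (X - C z) with hg
    have hfg : f = g * (X - C z) + C (f.eval z) := by
      conv_lhs => rw [← modByMonic_add_div f (X - C z), modByMonic_X_sub_C_eq_C_eval]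
      ring
    have hgdeg : g.natDegree < n := by
      rw [hg, natDegree_divByMonic f (monic_X_sub_C z), natDegree_X_sub_C]
      omega
    obtain ⟨F, hF, hFu⟩ := ih _ hgdeg g rfl
    -- Otherwise every coefficient of g (X - z) + f(z), in particular the one at `k₀`, would have
    -- value strictly above the minimum.
    have hj : ∃ j, val (g.coeff j) ≤ val (f.coeff k₀) := by
      by_contra! hcon
      have htop : val (f.coeff k₀) ≠ ⊤ := hlt.ne_top
      have hmul : ∀ j, val (f.coeff k₀) < val (g.coeff j * z) := by
        intro j
        rw [val.map_mul]
        exact (hcon j).trans_le (le_add_of_nonneg_right hz)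
      have : val (f.coeff k₀) < val (f.coeff k₀) := by
        conv_rhs => rw [hfg]
        rcases k₀ with _ | m
        · simp only [coeff_add, mul_coeff_zero, coeff_sub, coeff_X_zero, coeff_C_zero, zero_sub,
            mul_neg]
          refine val.map_lt_add ?_ hlt
          rw [val.map_neg]
          exact hmul 0
        · rw [coeff_add, coeff_mul_X_sub_C, coeff_C_succ, add_zero]
          rw [sub_eq_add_neg]
          refine val.map_lt_add (hcon m) ?_
          rw [val.map_neg]
          exact hmul _
      exact this.ne rfl
    obtain ⟨j, hj⟩ := hj
    refine ⟨insert z F, ?_, fun u hu hFz k => ?_⟩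
    · simpa [hz] using hF
    · have h1 := hFu u hu (fun z hz => hFz z (Finset.mem_insert_of_mem hz)) j
      have h2 := hFz z (Finset.mem_insert_self _ _)
      have h3 : val (g.eval u * (u - z)) ≤ val (f.coeff k₀) := by
        rw [val.map_mul, h2, add_zero]; exact h1.trans hj
      have h4 : val (f.eval u) = val (g.eval u * (u - z)) := by
        conv_lhs => rw [hfg]
        simp only [eval_add, eval_mul, eval_sub, eval_X, eval_C]
        exact val.map_add_eq_of_lt_left (h3.trans_lt hlt)
      rw [h4]
      exact h3.trans (hmin k)

/-- Rescaling by c of value δ reduces to generic residue classes, and avoiding the class of 0 as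
well makes the generic element a unit. For δ = ∞ only x = 0 is possible. -/
theorem exists_generic [IsAlgClosed L] (hval : Function.Surjective val) {ι : Type*} [Finite ι]
    (f : ι → L[X]) (δ : WithTop Γ) :
    ∃ x, val x = δ ∧ ∀ i k, val ((f i).eval x) ≤ val ((f i).coeff k) + k • δ := by
  classical
  have := Fintype.ofFinite ι
  by_cases hδ : δ = ⊤
  · subst hδ
    refine ⟨0, val.map_zero, fun i k => ?_⟩
    rcases k with _ | k
    · simp [← coeff_zero_eq_eval_zero]
    · simp [succ_nsmul]
  obtain ⟨c, hc⟩ := hval δ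
  have hc0 : c ≠ 0 := by rintro rfl; exact hδ (by simpa using hc.symm)
  choose F hF hFu using fun i => exists_val_eval_le_of_generic val ((f i).comp (C c * X))
  obtain ⟨u, hu, hus⟩ := exists_val_sub_eq_zero val
    (insert 0 (Finset.univ.biUnion F)) (by
      intro z hz
      rcases Finset.mem_insert.1 hz with rfl | hz
      · simp
      · obtain ⟨i, _, hi⟩ := Finset.mem_biUnion.1 hz
        exact hF i z hi)
  refine ⟨c * u, ?_, fun i k => ?_⟩
  · have := hus 0 (Finset.mem_insert_self _ _)
    rw [sub_zero] at this
    rw [val.map_mul, this, add_zero, hc]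
  · have := hFu i u hu (fun z hz => hus z (Finset.mem_insert_of_mem
      (Finset.mem_biUnion.2 ⟨i, Finset.mem_univ _, hz⟩))) k
    rw [eval_comp, comp_C_mul_X_coeff, val.map_mul, val.map_pow, hc] at this
    simpa using this

/-- The hypothesis says that no root is strictly closer to y than 0 is. The bound is stable under
products, so linear factors suffice; there val(y - z) ≤ val y forces val(y - z) ≤ val z too. -/
theorem val_eval_le_of_nearest_root [IsAlgClosed L] (f : L[X]) (y : L)
    (h : f ≠ 0 → ∀ z, f.eval z = 0 → val (y - z) ≤ val y) (k : ℕ) :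
    val (f.eval y) ≤ val (f.coeff k) + k • val y := by
  by_cases hf : f = 0
  · simp [hf]
  have hroots : ∀ z ∈ f.roots, val (y - z) ≤ val y := fun z hz => h hf z (mem_roots'.1 hz).2
  have hmul : ∀ p q : L[X], (∀ k, val (p.eval y) ≤ val (p.coeff k) + k • val y) →
      (∀ k, val (q.eval y) ≤ val (q.coeff k) + k • val y) →
      ∀ k, val ((p * q).eval y) ≤ val ((p * q).coeff k) + k • val y := by
    intro p q hp hq k
    by_cases htop : k • val y = ⊤
    · simp [htop]
    obtain ⟨γ, hγ⟩ := WithTop.ne_top_iff_exists.1 htop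
    rw [coeff_mul, ← hγ]
    -- Moving k • val y to the left gives a lower bound common to all terms of the convolution, as
    -- the ultrametric inequality requires.
    have : ∀ x ∈ Finset.HasAntidiagonal.antidiagonal k, val (eval y (p * q)) + ((-γ : Γ) : WithTop Γ) ≤
        val (p.coeff x.1 * q.coeff x.2) := by
      rintro ⟨a, b⟩ hab
      have hab' : a + b = k := Finset.HasAntidiagonal.mem_antidiagonal.1 hab
      have := add_le_add (hp a) (hq b)
      rw [eval_mul, val.map_mul, val.map_mul]
      calc _ ≤ val (p.coeff a) + a • val y + (val (q.coeff b) + b • val y) +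
              ((-γ : Γ) : WithTop Γ) := by gcongr
        _ = val (p.coeff a) + val (q.coeff b) + ((a + b) • val y + ((-γ : Γ) : WithTop Γ)) := by
            rw [add_nsmul]; abel
        _ = _ := by
            rw [hab', ← hγ, ← WithTop.coe_add]; simp
    have h2 := val.map_le_sum this
    calc val (eval y (p * q)) = val (eval y (p * q)) + ((-γ : Γ) : WithTop Γ) + γ := by
          rw [add_assoc, ← WithTop.coe_add]; simp
      _ ≤ _ := by gcongr
  have hs : ∀ s : Multiset L, (∀ z ∈ s, val (y - z) ≤ val y) → ∀ k,
      val ((s.map fun z => X - C z).prod.eval y) ≤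
        val ((s.map fun z => X - C z).prod.coeff k) + k • val y := by
    intro s
    induction s using Multiset.induction_on with
    | empty =>
      intro _ k
      rcases k with _ | k
      · simp
      · simp [coeff_one]
    | cons z s ih =>
      intro hs
      rw [Multiset.map_cons, Multiset.prod_cons]
      refine hmul _ _ (fun k => ?_) (ih fun z hz => hs z (Multiset.mem_cons_of_mem hz))
      have hz := hs z (Multiset.mem_cons_self _ _)
      rcases k with _ | _ | k
      · have := val.map_sub y (y - z)
        rw [min_eq_right hz] at this
        simpa using this
      · simpa [coeff_X] using hz
      · simp [coeff_X]
  rw [(IsAlgClosed.splits f).eq_prod_roots]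
  refine hmul _ _ (fun k => ?_) (hs _ hroots) k
  rcases k with _ | k <;> simp

/-- Among all products f_i g_j the one at (a, b) has strictly least value, and it occurs only in the
coefficient of index a + b. -/
theorem dominant_coeff_mul {f g : L[X]} {a b : ℕ} (hf : ∀ l, l ≠ a → val (f.coeff a) < val (f.coeff l))
    (hg : ∀ l, l ≠ b → val (g.coeff b) < val (g.coeff l)) :
    ∀ l, l ≠ a + b → val ((f * g).coeff (a + b)) < val ((f * g).coeff l) := by
  have hfa : val (f.coeff a) ≠ ⊤ := (hf (a + 1) (by omega)).ne_top
  have hgb : val (g.coeff b) ≠ ⊤ := (hg (b + 1) (by omega)).ne_top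
  have hterm : ∀ i j, (i, j) ≠ (a, b) → val (f.coeff a * g.coeff b) < val (f.coeff i * g.coeff j) := by
    intro i j hij
    rw [val.map_mul, val.map_mul]
    by_cases hi : i = a
    · subst hi
      have hj : j ≠ b := by rintro rfl; exact hij rfl
      exact WithTop.add_lt_add_left hfa (hg j hj)
    · refine (WithTop.add_lt_add_right hgb (hf i hi)).trans_le ?_
      by_cases hj : j = b
      · rw [hj]
      · gcongr
        exact (hg j hj).le
  have hab : val ((f * g).coeff (a + b)) = val (f.coeff a * g.coeff b) := by
    rw [coeff_mul]
    refine val_sum_eq_of_unique val _ (fun x : ℕ × ℕ => f.coeff x.1 * g.coeff x.2) (i := (a, b))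
      (by simp) fun x _ hx => hterm x.1 x.2 hx
  intro l hl
  rw [hab, coeff_mul]
  refine val.map_lt_sum ?_ fun x hx => hterm _ _ ?_
  · rw [val.map_mul]
    exact WithTop.add_ne_top.2 ⟨hfa, hgb⟩
  · rintro h
    have := Finset.HasAntidiagonal.mem_antidiagonal.1 hx
    simp only [Prod.mk.injEq] at h
    omega

/-- A polynomial has a root of value `0` if and only if no coefficient is dominant. -/
theorem exists_root_val_eq_zero_iff [IsAlgClosed L] {h : L[X]} (h0 : h ≠ 0) :
    (∃ z, h.eval z = 0 ∧ val z = 0) ↔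
      ¬ ∃ k, ∀ l, l ≠ k → val (h.coeff k) < val (h.coeff l) := by
  constructor
  · rintro ⟨z, hz, hz0⟩ ⟨k, hk⟩
    have hkt : val (h.coeff k) ≠ ⊤ := (hk (k + 1) (by omega)).ne_top
    have hmem : k ∈ Finset.range (h.natDegree + 1) := by
      by_contra hcon
      rw [Finset.mem_range, not_lt] at hcon
      rw [coeff_eq_zero_of_natDegree_lt (by omega)] at hkt
      simp at hkt
    have : val (h.eval z) = val (h.coeff k * z ^ k) := by
      rw [eval_eq_sum_range]
      refine val_sum_eq_of_unique val _ (fun i => h.coeff i * z ^ i) hmem fun j _ hj => ?_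
      simpa [val.map_mul, val.map_pow, hz0] using hk j hj
    rw [hz, val.map_zero, val.map_mul, val.map_pow, hz0] at this
    simp at this
    exact hkt this.symm
  · contrapose!
    intro hcon
    -- A factor X - z with val z ≠ 0 has a dominant coefficient, the constant one if val z < 0 and
    -- the leading one if val z > 0; dominance is multiplicative.
    have hs : ∀ s : Multiset L, (∀ z ∈ s, val z ≠ 0) →
        ∃ k, ∀ l, l ≠ k → val ((s.map fun z => X - C z).prod.coeff k) <
          val ((s.map fun z => X - C z).prod.coeff l) := by
      intro s
      induction s using Multiset.induction_on with
      | empty =>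
        intro _
        refine ⟨0, fun l hl => ?_⟩
        simp [coeff_one, hl]
      | cons z s ih =>
        intro hs
        obtain ⟨k, hk⟩ := ih fun z hz => hs z (Multiset.mem_cons_of_mem hz)
        have hz := hs z (Multiset.mem_cons_self _ _)
        have hlin : ∃ k, ∀ l, l ≠ k → val ((X - C z).coeff k) < val ((X - C z).coeff l) := by
          rcases lt_or_gt_of_ne hz with hlt | hgt
          · refine ⟨0, fun l hl => ?_⟩
            rcases l with _ | _ | l
            · exact absurd rfl hl
            · simpa [coeff_X] using hlt
            · simpa [coeff_X] using hlt.trans_le le_top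
          · refine ⟨1, fun l hl => ?_⟩
            rcases l with _ | _ | l
            · simpa [coeff_X] using hgt
            · exact absurd rfl hl
            · simp [coeff_X]
        obtain ⟨a, ha⟩ := hlin
        rw [Multiset.map_cons, Multiset.prod_cons]
        exact ⟨a + k, dominant_coeff_mul val ha hk⟩
    obtain ⟨k, hk⟩ := hs h.roots fun z hz => hcon z (mem_roots'.1 hz).2
    have hC : ∀ l, l ≠ 0 → val ((C h.leadingCoeff).coeff 0) < val ((C h.leadingCoeff).coeff l) := by
      intro l hl
      simp [coeff_C, hl, lt_top_iff_ne_top, val.top_iff, h0]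
    rw [(IsAlgClosed.splits h).eq_prod_roots]
    exact ⟨0 + k, dominant_coeff_mul val hC hk⟩

/-- The slopes of the Newton polygon of a polynomial are the values of its roots. -/
theorem exists_root_val_eq_iff [IsAlgClosed L] (hval : Function.Surjective val) {h : L[X]}
    (h0 : h ≠ 0) {u : WithTop Γ} (hu : u ≠ ⊤) {N : ℕ} (hN : h.natDegree < N) :
    (∃ z, h.eval z = 0 ∧ val z = u) ↔
      ¬ ∃ k : Fin N, val (h.coeff k) ≠ ⊤ ∧ ∀ l : Fin N, l ≠ k →
        ¬ val (h.coeff l) + (l : ℕ) • u ≤ val (h.coeff k) + (k : ℕ) • u := by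
  -- Substituting c X with val c = u turns roots of value u into roots of value 0 and adds k • u to
  -- the value of the k-th coefficient.
  obtain ⟨c, hc⟩ := hval u
  have hc0 : c ≠ 0 := by rintro rfl; exact hu (by simpa using hc.symm)
  have hcoeff : ∀ k, val ((h.comp (C c * X)).coeff k) = val (h.coeff k) + k • u := by
    intro k
    rw [comp_C_mul_X_coeff, val.map_mul, val.map_pow, hc]
  have hne : h.comp (C c * X) ≠ 0 := by
    intro h1
    apply h0
    ext k
    have := congrArg (fun p : L[X] => p.coeff k) h1
    simpa [comp_C_mul_X_coeff, hc0] using this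
  have h1 : (∃ z, h.eval z = 0 ∧ val z = u) ↔
      ∃ z, (h.comp (C c * X)).eval z = 0 ∧ val z = 0 := by
    constructor
    · rintro ⟨z, hz, hzu⟩
      refine ⟨z / c, ?_, ?_⟩
      · simpa [eval_comp, mul_div_cancel₀ z hc0] using hz
      · obtain ⟨γ, rfl⟩ := WithTop.ne_top_iff_exists.1 hu
        have := val.map_mul (z / c) c
        rw [div_mul_cancel₀ z hc0, hzu, hc] at this
        have h2 : ((0 : WithTop Γ)) + γ = val (z / c) + γ := by rw [zero_add]; exact this
        exact (WithTop.add_right_cancel WithTop.coe_ne_top h2).symm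
    · rintro ⟨z, hz, hz0⟩
      exact ⟨c * z, by simpa [eval_comp] using hz, by rw [val.map_mul, hz0, hc, add_zero]⟩
  rw [h1, exists_root_val_eq_zero_iff val hne, not_iff_not]
  simp only [hcoeff]
  have hku : ∀ k : ℕ, k • u ≠ ⊤ := by
    intro k
    obtain ⟨γ, rfl⟩ := WithTop.ne_top_iff_exists.1 hu
    rw [← WithTop.coe_nsmul]
    exact WithTop.coe_ne_top
  constructor
  · rintro ⟨k, hk⟩
    have hkt : val (h.coeff k) ≠ ⊤ := by
      have := (hk (k + 1) (by omega)).ne_top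
      exact (WithTop.add_ne_top.1 this).1
    have hkN : k < N := by
      by_contra hcon
      rw [coeff_eq_zero_of_natDegree_lt (by omega)] at hkt
      simp at hkt
    exact ⟨⟨k, hkN⟩, hkt, fun l hl => not_le.2 (hk l fun h => hl (Fin.ext h))⟩
  · rintro ⟨k, hkt, hk⟩
    refine ⟨k, fun l hl => ?_⟩
    by_cases hlN : l < N
    · exact not_le.1 (hk ⟨l, hlN⟩ fun h => hl (congrArg Fin.val h))
    -- Coefficients from index `N` on vanish; they are dominated because the value at `k` is finite.
    · rw [coeff_eq_zero_of_natDegree_lt (n := l) (by omega)]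
      rw [val.map_zero, top_add, lt_top_iff_ne_top]
      exact WithTop.add_ne_top.2 ⟨hkt, hku k⟩

end Polynomials

/-! ### Resultants as norms of polynomial values at roots -/

section Norm

open Polynomial

variable {A : Type*} [CommRing A] {L : Type*} [Field L]

/-- The outer variable detects nonvanishing of the s_j: if some s_j ≠ 0, its degree is positive and
the leading coefficient is a nonzero constant; otherwise only X - c is left. Leading coefficients
thus ignore all but the common zeros. -/
theorem leadingCoeff_norm_factor {m : ℕ} (c : L) (s : Fin m → L) (z : L) :
    (C X - C (C c) - ∑ j : Fin m, X ^ ((j : ℕ) + 1) * C (C (s j)) : L[X][X]) ≠ 0 ∧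
    ((C X - C (C c) - ∑ j : Fin m, X ^ ((j : ℕ) + 1) * C (C (s j)) : L[X][X]).leadingCoeff.eval z = 0 ↔
      (∀ j, s j = 0) ∧ c = z) := by
  by_cases hs : ∀ j, s j = 0
  · have h1 : (C X - C (C c) - ∑ j : Fin m, X ^ ((j : ℕ) + 1) * C (C (s j)) : L[X][X]) = C (X - C c) := by
      simp [hs]
    rw [h1, leadingCoeff_C]
    exact ⟨C_ne_zero.2 (X_sub_C_ne_zero c), by simp [hs, sub_eq_zero, eq_comm]⟩
  · set S : L[X] := ∑ j : Fin m, X ^ ((j : ℕ) + 1) * C (s j) with hS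
    have h1 : (∑ j : Fin m, X ^ ((j : ℕ) + 1) * C (C (s j)) : L[X][X]) = S.map C := by
      simp [hS, Polynomial.map_sum]
    have hcoeff : ∀ j : Fin m, S.coeff (j + 1) = s j := by
      intro j
      simp only [hS, finsetSum_coeff, coeff_X_pow_mul', coeff_C]
      rw [Finset.sum_eq_single j]
      · simp
      · intro i _ hij
        have : (i : ℕ) ≠ j := fun h => hij (Fin.ext h)
        split_ifs <;> first | rfl | omega
      · simp
    push Not at hs
    obtain ⟨j, hj⟩ := hs
    have hdeg : 0 < S.natDegree :=
      (Nat.succ_pos j).trans_le (le_natDegree_of_ne_zero (by rw [hcoeff]; exact hj))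
    have hS0 : S ≠ 0 := by rintro h; simp [h] at hdeg
    have hlt : (C X - C (C c) : L[X][X]).degree < (S.map C).degree := by
      rw [degree_map_eq_of_injective C_injective, ← C_sub]
      exact degree_C_le.trans_lt (natDegree_pos_iff_degree_pos.1 hdeg)
    have hlc : (C X - C (C c) - S.map C : L[X][X]).leadingCoeff = -C S.leadingCoeff := by
      rw [leadingCoeff_sub_of_degree_lt' hlt, leadingCoeff_map_of_injective C_injective]
    have hne : S.leadingCoeff ≠ 0 := leadingCoeff_ne_zero.2 hS0
    rw [h1, hlc]
    refine ⟨fun h0 => ?_, ?_⟩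
    · rw [h0, leadingCoeff_zero] at hlc
      simp [hS0] at hlc
    · simp only [eval_neg, eval_C, neg_eq_zero, hne, false_iff]
      exact fun h => hj (h.1 j)

/-- The values of a polynomial `Q` at the common roots of `q` and the `s j` are the roots of a
polynomial with coefficients in the base ring, uniformly in specializations of the base ring. -/
theorem exists_norm [IsAlgClosed L] (q Q : A[X]) {m : ℕ} (s : Fin m → A[X]) (d : ℕ) :
    ∃ N : A[X][X], ∀ φ : A →+* L, (q.map φ).natDegree = d → q.map φ ≠ 0 →
      N.map (mapRingHom φ) ≠ 0 ∧ ∀ z, (N.map (mapRingHom φ)).leadingCoeff.eval z = 0 ↔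
        ∃ α, (q.map φ).eval α = 0 ∧ (∀ j, ((s j).map φ).eval α = 0) ∧ (Q.map φ).eval α = z := by
  let κ : A →+* A[X][X] := (C : A[X] →+* A[X][X]).comp C
  -- From the outside in, the variables are the root α, the marker of the s_j, and z. The marker
  -- exponents start at 1 so that the s_j do not mix with z - Q(α).
  let h : A[X][X][X] := C (C X) - Q.map κ - ∑ j : Fin m, C (X ^ ((j : ℕ) + 1)) * (s j).map κ
  -- The formal degrees are fixed, so the resultant commutes with specialization; `d` is the degree
  -- of q after specialization, which may be smaller than that of q.
  refine ⟨resultant (q.map κ) h d h.natDegree, fun φ hd hq => ?_⟩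
  let κ' : L →+* L[X][X] := (C : L[X] →+* L[X][X]).comp C
  let Φ : A[X][X] →+* L[X][X] := mapRingHom (mapRingHom φ)
  have hκ : Φ.comp κ = κ'.comp φ := by
    ext a
    simp [Φ, κ, κ']
  have hκ' : Function.Injective κ' := C_injective.comp C_injective
  -- The product formula for the resultant over the roots of the specialized q.
  have hN : (resultant (q.map κ) h d h.natDegree).map (mapRingHom φ) =
      κ' (q.map φ).leadingCoeff ^ h.natDegree *
        ((q.map φ).roots.map fun α => (h.map Φ).eval (κ' α)).prod := by
    have h1 : (resultant (q.map κ) h d h.natDegree).map (mapRingHom φ) =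
        resultant ((q.map φ).map κ') (h.map Φ) ((q.map φ).map κ').natDegree h.natDegree := by
      have h2 : (q.map φ).map κ' = (q.map κ).map Φ := by
        rw [Polynomial.map_map, Polynomial.map_map, hκ]
      rw [natDegree_map_eq_of_injective hκ', hd, h2, resultant_map_map]
      rfl
    rw [h1, resultant_eq_prod_eval _ _ _ natDegree_map_le ((IsAlgClosed.splits _).map _),
      leadingCoeff_map_of_injective hκ', (IsAlgClosed.splits (q.map φ)).roots_map, Multiset.map_map]
    rfl
  have heval : ∀ α, (h.map Φ).eval (κ' α) = C X - C (C ((Q.map φ).eval α)) -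
      ∑ j : Fin m, X ^ ((j : ℕ) + 1) * C (C (((s j).map φ).eval α)) := by
    intro α
    have hmap : ∀ p : A[X], eval (κ' α) ((p.map κ).map Φ) = C (C ((p.map φ).eval α)) := by
      intro p
      rw [Polynomial.map_map, hκ, ← Polynomial.map_map, eval_map, eval₂_at_apply]
      rfl
    simp only [h, Polynomial.map_sub, Polynomial.map_sum, Polynomial.map_mul, eval_sub, hmap,
      eval_finsetSum, eval_mul, map_C, eval_C]
    simp [Φ]
  have hfac := fun α z => leadingCoeff_norm_factor ((Q.map φ).eval α)
    (fun j => ((s j).map φ).eval α) z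
  have hlc : (q.map φ).leadingCoeff ≠ 0 := leadingCoeff_ne_zero.2 hq
  rw [hN]
  constructor
  · refine mul_ne_zero (pow_ne_zero _ fun h0 => hlc (hκ' (by simpa using h0)))
      (Multiset.prod_ne_zero fun h0 => ?_)
    obtain ⟨α, _, hα⟩ := Multiset.mem_map.1 h0
    exact (hfac α 0).1 (heval α ▸ hα)
  · intro z
    have hκlc : (κ' (q.map φ).leadingCoeff ^ h.natDegree).leadingCoeff =
        C ((q.map φ).leadingCoeff ^ h.natDegree) := by
      rw [leadingCoeff_pow]
      simp [κ']
    rw [leadingCoeff_mul, hκlc, leadingCoeff_multiset_prod, Multiset.map_map, eval_mul, eval_C,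
      eval_multiset_prod, Multiset.map_map, mul_eq_zero, or_iff_right (pow_ne_zero _ hlc),
      Multiset.prod_eq_zero_iff, Multiset.mem_map]
    refine exists_congr fun α => ?_
    rw [mem_roots', IsRoot]
    simp only [Function.comp_apply, heval]
    rw [(hfac α z).2]
    tauto

end Norm

/-! ### Recovering a tuple of values from weighted sums -/

section Vandermonde

variable {Γ : Type*} [AddCommGroup Γ] [LinearOrder Γ] [IsOrderedAddMonoid Γ]

/-- Multiplying the Vandermonde system by the adjugate matrix gives det • x = 0 with nonzero
determinant, and an ordered group has no torsion. -/
theorem eq_zero_of_sum_pow_smul_eq_zero {r : ℕ} (x : Fin r → Γ) (s : Finset ℕ) (hs : r ≤ s.card)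
    (h : ∀ t ∈ s, ∑ j : Fin r, t ^ (j : ℕ) • x j = 0) : x = 0 := by
  classical
  obtain ⟨e⟩ : Nonempty (Fin r ↪ s) := by
    refine Function.Embedding.nonempty_of_card_le ?_
    simpa using hs
  let V : Matrix (Fin r) (Fin r) ℤ := Matrix.vandermonde fun i => ((e i : ℕ) : ℤ)
  have hdet : V.det ≠ 0 := Matrix.det_vandermonde_ne_zero_iff.2 fun i j hij =>
    e.injective (Subtype.ext (by exact_mod_cast hij))
  have hV : ∀ i, ∑ j, V i j • x j = 0 := by
    intro i
    rw [← h (e i) (e i).2]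
    refine Finset.sum_congr rfl fun j _ => ?_
    simp only [V, Matrix.vandermonde_apply]
    rw [← Nat.cast_pow, natCast_zsmul]
  funext k
  have h1 : V.det • x k = ∑ j, (V.adjugate * V) k j • x j := by
    rw [Matrix.adjugate_mul, Finset.sum_eq_single k]
    · simp
    · intro j _ hj
      simp [Matrix.one_apply_ne hj.symm]
    · simp
  have h2 : ∑ j, (V.adjugate * V) k j • x j = ∑ i, V.adjugate k i • ∑ j, V i j • x j := by
    simp only [Matrix.mul_apply, Finset.sum_smul, Finset.smul_sum, mul_smul]
    exact Finset.sum_comm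
  rw [h2] at h1
  simp only [hV, smul_zero, Finset.sum_const_zero] at h1
  exact (smul_eq_zero.1 h1).resolve_left hdet

set_option linter.unusedSectionVars false in
theorem nsmul_ne_top (n : ℕ) {x : WithTop Γ} (hx : x ≠ ⊤) : n • x ≠ ⊤ := by
  obtain ⟨γ, rfl⟩ := WithTop.ne_top_iff_exists.1 hx
  rw [← WithTop.coe_nsmul]
  exact WithTop.coe_ne_top

/-- By pigeonhole, among d r + 1 weights more than r share the same α; for that α the Vandermonde
system forces all entries to agree. -/
theorem exists_eq_of_forall_weight {β : Type*} (R : Finset β) {r d : ℕ} (hd : R.card ≤ d)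
    (J : Finset (Fin r)) (v : β → Fin r → WithTop Γ) (w : Fin r → WithTop Γ)
    (hw : ∀ j ∈ J, w j ≠ ⊤)
    (h : ∀ t : Fin (d * r + 1), ∃ α ∈ R, ∑ j ∈ J, ((t : ℕ) + 1) ^ (j : ℕ) • v α j =
      ∑ j ∈ J, ((t : ℕ) + 1) ^ (j : ℕ) • w j) :
    ∃ α ∈ R, ∀ j ∈ J, v α j = w j := by
  classical
  choose a haR ha using h
  obtain ⟨α, hα, hcard⟩ := Finset.exists_lt_card_fiber_of_mul_lt_card_of_maps_to
    (s := (Finset.univ : Finset (Fin (d * r + 1)))) (t := R) (f := a) (n := r)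
    (fun t _ => haR t) (by
      rw [Finset.card_univ, Fintype.card_fin]
      exact Nat.lt_succ_of_le (Nat.mul_le_mul_right r hd))
  refine ⟨α, hα, ?_⟩
  have hsum : ∀ t ∈ Finset.univ.filter fun t => a t = α,
      ∑ j ∈ J, ((t : ℕ) + 1) ^ (j : ℕ) • v α j = ∑ j ∈ J, ((t : ℕ) + 1) ^ (j : ℕ) • w j := by
    intro t ht
    rw [← (Finset.mem_filter.1 ht).2, ha]
  obtain ⟨t₀, ht₀⟩ : (Finset.univ.filter fun t => a t = α).Nonempty :=
    Finset.card_pos.1 (by omega)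
  -- The multipliers (t + 1)^j are positive, the reason for the shift by 1, so an infinite entry
  -- would make the sum infinite.
  have hv : ∀ j ∈ J, v α j ≠ ⊤ := by
    intro j hj htop
    have h1 := hsum t₀ ht₀
    have h2 : ∑ j ∈ J, ((t₀ : ℕ) + 1) ^ (j : ℕ) • w j ≠ ⊤ :=
      WithTop.sum_ne_top.2 fun j hj => nsmul_ne_top _ (hw j hj)
    rw [← h1] at h2
    have h3 := WithTop.sum_ne_top.1 h2 j hj
    obtain ⟨n, hn⟩ := Nat.exists_eq_succ_of_ne_zero
      (pow_pos (Nat.succ_pos (t₀ : ℕ)) (j : ℕ)).ne'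
    rw [show ((t₀ : ℕ) + 1) ^ (j : ℕ) = n + 1 from hn, htop, succ_nsmul, add_top] at h3
    exact h3 rfl
  let x : Fin r → Γ := fun j => if j ∈ J then (v α j).untopD 0 - (w j).untopD 0 else 0
  have hx : x = 0 := by
    refine eq_zero_of_sum_pow_smul_eq_zero x
      ((Finset.univ.filter fun t => a t = α).image fun t : Fin (d * r + 1) => (t : ℕ) + 1) ?_ ?_
    · rw [Finset.card_image_of_injective _ fun i j hij => Fin.ext (by simpa using hij)]
      exact hcard.le
    · intro t ht
      obtain ⟨t, ht', rfl⟩ := Finset.mem_image.1 ht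
      have h1 := hsum t ht'
      have hc : ∀ u : Fin r → WithTop Γ, (∀ j ∈ J, u j ≠ ⊤) →
          ∑ j ∈ J, ((t : ℕ) + 1) ^ (j : ℕ) • u j =
            ((∑ j ∈ J, ((t : ℕ) + 1) ^ (j : ℕ) • (u j).untopD 0 : Γ) : WithTop Γ) := by
        intro u hu
        rw [WithTop.coe_sum]
        refine Finset.sum_congr rfl fun j hj => ?_
        obtain ⟨γ, hγ⟩ := WithTop.ne_top_iff_exists.1 (hu j hj)
        rw [← hγ, WithTop.untopD_coe, WithTop.coe_nsmul]
      rw [hc _ hv, hc _ hw, WithTop.coe_inj] at h1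
      simp only [x, smul_ite, smul_zero, ← Finset.sum_filter, Finset.filter_mem_eq_inter,
        Finset.univ_inter, smul_sub, Finset.sum_sub_distrib]
      rw [h1, sub_self]
  intro j hj
  have := congrFun hx j
  simp only [x, hj, if_true, Pi.zero_apply, sub_eq_zero] at this
  obtain ⟨γ, hγ⟩ := WithTop.ne_top_iff_exists.1 (hv j hj)
  obtain ⟨γ', hγ'⟩ := WithTop.ne_top_iff_exists.1 (hw j hj)
  rw [← hγ, ← hγ'] at this ⊢
  simpa using this

end Vandermonde

/-! ### Elimination of a field quantifier -/

section Elimination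

open Polynomial

/-- The degree after specialization becomes finitely many vanishing conditions on coefficients, and
vanishing is a condition on values. -/
theorem Polynomial.natDegree_map_eq_and_ne_zero_iff {R S : Type*} [CommRing R] [CommRing S]
    (p : R[X]) (ψ : R →+* S) (d : ℕ) :
    ((p.map ψ).natDegree = d ∧ p.map ψ ≠ 0) ↔
      ψ (p.coeff d) ≠ 0 ∧ ∀ k : Fin (p.natDegree + 1), d < k → ψ (p.coeff k) = 0 := by
  constructor
  · rintro ⟨rfl, h0⟩
    refine ⟨?_, fun k hk => ?_⟩
    · rw [← coeff_map]
      exact leadingCoeff_ne_zero.2 h0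
    · rw [← coeff_map]
      exact coeff_eq_zero_of_natDegree_lt hk
  · rintro ⟨h1, h2⟩
    rw [← coeff_map] at h1
    refine ⟨natDegree_eq_of_le_of_coeff_ne_zero ?_ h1, fun h0 => by simp [h0] at h1⟩
    refine natDegree_le_iff_coeff_eq_zero.2 fun k hk => ?_
    rw [coeff_map]
    by_cases hkp : k < p.natDegree + 1
    · exact h2 ⟨k, hkp⟩ hk
    · rw [coeff_eq_zero_of_natDegree_lt (by omega), map_zero]

theorem Polynomial.map_hasseDeriv {R S : Type*} [CommRing R] [CommRing S]
    (p : R[X]) (ψ : R →+* S) (k : ℕ) :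
    (hasseDeriv k p).map ψ = hasseDeriv k (p.map ψ) := by
  ext n
  simp [hasseDeriv_coeff]

variable {L : Type*} [Field L] {Γ : Type*} [AddCommGroup Γ] [LinearOrder Γ]
  [IsOrderedAddMonoid Γ] (val : AddValuation L (WithTop Γ)) (A : Type*) [CommRing A]

/-- The functions `φ ↦ val (φ a)` on the set of specializations of the ring `A` in `L`. -/
def specializedValues : Set ((A →+* L) → WithTop Γ) := {f | ∃ a, f = fun φ => val (φ a)}

variable {A}

theorem definableFunOver_specializedValues (a : A) :
    DefinableFunOver (specializedValues val A) (fun φ => val (φ a)) := .of_mem ⟨a, rfl⟩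

theorem definableOver_spec_eq_zero (a : A) :
    DefinableOver (specializedValues val A) {φ | φ a = 0} := by
  simpa [val.top_iff] using! DefinableOver.eq_top (definableFunOver_specializedValues val a)

theorem definableOver_map_eq_zero (p : A[X]) :
    DefinableOver (specializedValues val A) {φ | p.map φ = 0} := by
  have := DefinableOver.iInter fun k : Fin (p.natDegree + 1) =>
    definableOver_spec_eq_zero val (p.coeff k)
  convert! this using 1
  ext φ
  simp only [mem_ofPred_eq, mem_iInter]
  constructor
  · intro h k
    rw [← coeff_map, h, coeff_zero]
  · intro h
    ext k
    rw [coeff_map, coeff_zero]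
    by_cases hk : k < p.natDegree + 1
    · exact h ⟨k, hk⟩
    · rw [coeff_eq_zero_of_natDegree_lt (by omega), map_zero]

theorem definableOver_natDegree_eq (p : A[X]) (d : ℕ) :
    DefinableOver (specializedValues val A)
      {φ | (p.map φ).natDegree = d ∧ p.map φ ≠ 0} := by
  simp only [natDegree_map_eq_and_ne_zero_iff]
  exact (definableOver_spec_eq_zero val (p.coeff d)).not.and <| .forall fun k =>
    (DefinableOver.const _).imp (definableOver_spec_eq_zero val (p.coeff k))

theorem definableOver_natDegree_eq' (p : A[X][X]) (d : ℕ) :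
    DefinableOver (specializedValues val A)
      {φ | (p.map (mapRingHom φ)).natDegree = d ∧ p.map (mapRingHom φ) ≠ 0} := by
  simp only [natDegree_map_eq_and_ne_zero_iff]
  exact (definableOver_map_eq_zero val (p.coeff d)).not.and <| .forall fun k =>
    (DefinableOver.const _).imp (definableOver_map_eq_zero val (p.coeff k))

theorem DefinableOver.withCoords_fst {E : Type*} {𝓕 : Set (E → WithTop Γ)} {κ : Type}
    {D : Set E} (hD : DefinableOver 𝓕 D) :
    DefinableOver (withCoords 𝓕 κ) {e | e.1 ∈ D} :=
  hD.preimage (k := Prod.fst) fun _ hg => .withCoords_fst (.of_mem hg)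

/-- The values Q(α) are the roots of the leading coefficient of the norm polynomial N, to which the
Newton polygon criterion applies. As the degree of N may drop under specialization, all possible
degrees n are tried. The criterion needs a finite slope, hence the condition excluding ⊤. -/
theorem definableOver_exists_root_val_eq [IsAlgClosed L] (hval : Function.Surjective val)
    (q Q : A[X]) {m : ℕ} (s : Fin m → A[X]) (d : ℕ) :
    DefinableOver (withCoords (specializedValues val A) Unit)
      {e | ((q.map e.1).natDegree = d ∧ q.map e.1 ≠ 0) ∧ e.2 () ≠ ⊤ ∧
        ∃ α, (q.map e.1).eval α = 0 ∧ (∀ j, ((s j).map e.1).eval α = 0) ∧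
          val ((Q.map e.1).eval α) = e.2 ()} := by
  obtain ⟨N, hN⟩ := exists_norm (L := L) q Q s d
  let c : ℕ → ℕ → (A →+* L) × (Unit → WithTop Γ) → WithTop Γ :=
    fun n k e => val (e.1 ((N.coeff n).coeff k))
  have hc : ∀ n k, DefinableFunOver (withCoords (specializedValues val A) Unit) (c n k) :=
    fun n k => .withCoords_fst (definableFunOver_specializedValues val _)
  have hu := DefinableFunOver.withCoords_snd (𝓕 := specializedValues val A) ()
  have key : ∀ n : ℕ, DefinableOver (withCoords (specializedValues val A) Unit)
      {e | ¬ ∃ k : Fin ((N.coeff n).natDegree + 1), c n k e ≠ ⊤ ∧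
        ∀ l : Fin ((N.coeff n).natDegree + 1), l ≠ k →
        ¬ c n l e + (l : ℕ) • e.2 () ≤ c n k e + (k : ℕ) • e.2 ()} := by
    intro n
    exact .not <| .exists fun k => (DefinableOver.eq_top (hc n k)).not.and <| .forall fun l =>
      (DefinableOver.const (l ≠ k)).imp
        (DefinableOver.le ((hc n l).add (hu.nsmul l)) ((hc n k).add (hu.nsmul k))).not
  refine ((definableOver_natDegree_eq val q d).withCoords_fst.and <|
    (DefinableOver.eq_top hu).not.and <| .exists fun n : Fin (N.natDegree + 1) =>
      (definableOver_natDegree_eq' val N n).withCoords_fst.and (key n)).congr fun ⟨φ, u⟩ => ?_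
  simp only [mem_ofPred_eq]
  refine and_congr_right fun hq => and_congr_right fun hu => ?_
  obtain ⟨hN0, hNz⟩ := hN φ hq.1 hq.2
  have h1 : (∃ α, (q.map φ).eval α = 0 ∧ (∀ j, ((s j).map φ).eval α = 0) ∧
      val ((Q.map φ).eval α) = u ()) ↔
      ∃ z, (N.map (mapRingHom φ)).leadingCoeff.eval z = 0 ∧ val z = u () := by
    simp only [hNz]
    constructor
    · rintro ⟨α, h1, h2, h3⟩
      exact ⟨_, ⟨α, h1, h2, rfl⟩, h3⟩
    · rintro ⟨_, ⟨α, h1, h2, rfl⟩, h3⟩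
      exact ⟨α, h1, h2, h3⟩
  have h2 : ∀ n, (N.map (mapRingHom φ)).natDegree = n →
      ((∃ z, (N.map (mapRingHom φ)).leadingCoeff.eval z = 0 ∧ val z = u ()) ↔
      ¬ ∃ k : Fin ((N.coeff n).natDegree + 1), c n k (φ, u) ≠ ⊤ ∧
        ∀ l : Fin ((N.coeff n).natDegree + 1), l ≠ k →
        ¬ c n l (φ, u) + (l : ℕ) • u () ≤ c n k (φ, u) + (k : ℕ) • u ()) := by
    rintro n rfl
    rw [exists_root_val_eq_iff val hval (leadingCoeff_ne_zero.2 hN0) hu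
      (N := (N.coeff (N.map (mapRingHom φ)).natDegree).natDegree + 1)]
    · simp only [leadingCoeff, coeff_map, coe_mapRingHom, c]
    · rw [leadingCoeff, coeff_map, coe_mapRingHom]
      exact Nat.lt_succ_of_le natDegree_map_le
  rw [h1]
  constructor
  · intro h
    exact ⟨⟨_, Nat.lt_succ_of_le (natDegree_map_le (f := mapRingHom φ) (p := N))⟩, ⟨rfl, hN0⟩,
      (h2 _ rfl).1 h⟩
  · rintro ⟨n, ⟨hn, -⟩, h⟩
    exact (h2 _ hn).2 h

/-- One root must realise r values simultaneously. On the set T of infinite values, vanishing of s_j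
is imposed. The rest is encoded in the products `Q T t`, whose value at α is the sum of (t + 1)^j
val s_j(α) over j outside T; with at most d roots, d r + 1 such weights t suffice. -/
theorem definableOver_exists_root_fin [IsAlgClosed L] (hval : Function.Surjective val)
    (q : A[X]) {r : ℕ} (s : Fin r → A[X]) :
    DefinableOver (withCoords (specializedValues val A) (Fin r))
      {e | q.map e.1 ≠ 0 ∧ ∃ α, (q.map e.1).eval α = 0 ∧
        ∀ j, val (((s j).map e.1).eval α) = e.2 j} := by
  classical
  let Q : Finset (Fin r) → ℕ → A[X] := fun T t => ∏ j ∈ Tᶜ, s j ^ (t + 1) ^ (j : ℕ)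
  let s' : Finset (Fin r) → Fin r → A[X] := fun T j => if j ∈ T then s j else 0
  let k : Finset (Fin r) → ℕ → (A →+* L) × (Fin r → WithTop Γ) → (A →+* L) × (Unit → WithTop Γ) :=
    fun T t e => (e.1, fun _ => ∑ j ∈ Tᶜ, (t + 1) ^ (j : ℕ) • e.2 j)
  have hk : ∀ T t, ∀ g ∈ withCoords (specializedValues val A) Unit,
      DefinableFunOver (withCoords (specializedValues val A) (Fin r)) (g ∘ k T t) := by
    rintro T t _ (⟨g, hg, rfl⟩ | ⟨_, rfl⟩)
    · exact .withCoords_fst (.of_mem hg)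
    · exact .sum fun j => (DefinableFunOver.withCoords_snd j).nsmul _
  refine (DefinableOver.exists fun d : Fin (q.natDegree + 1) =>
    .exists fun T : Finset (Fin r) =>
      (DefinableOver.forall fun j : Fin r => (DefinableOver.const (j ∈ T)).iff
        (.eq_top (.withCoords_snd j))).and <|
      .forall fun t : Fin (d * r + 1) =>
        (definableOver_exists_root_val_eq val hval q (Q T t) (s' T) d).preimage
          (hk T t)).congr fun ⟨φ, w⟩ => ?_
  simp only [mem_ofPred_eq, k]
  have hQ : ∀ T t α, val (((Q T t).map φ).eval α) =
      ∑ j ∈ Tᶜ, (t + 1) ^ (j : ℕ) • val (((s j).map φ).eval α) := by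
    intro T t α
    simp only [Q, Polynomial.map_prod, Polynomial.map_pow, eval_prod, eval_pow,
      val.map_prod_eq_sum, val.map_pow]
  have hs' : ∀ T α, (∀ j, ((s' T j).map φ).eval α = 0) ↔
      ∀ j ∈ T, ((s j).map φ).eval α = 0 := by
    intro T α
    refine forall_congr' fun j => ?_
    by_cases hj : j ∈ T <;> simp [s', hj]
  simp only [hQ, hs']
  constructor
  · rintro ⟨hq, α, hα, hw⟩
    refine ⟨⟨_, Nat.lt_succ_of_le (natDegree_map_le (f := φ) (p := q))⟩,
      Finset.univ.filter fun j => w j = ⊤, by simp, fun t => ⟨⟨rfl, hq⟩, ?_, α, hα, ?_, ?_⟩⟩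
    · refine WithTop.sum_ne_top.2 fun j hj => nsmul_ne_top _ ?_
      simpa using hj
    · intro j hj
      simpa [← hw] using hj
    · simp only [hw]
  · rintro ⟨d, T, hT, h⟩
    obtain ⟨⟨hd, hq⟩, -⟩ := h 0
    refine ⟨hq, ?_⟩
    obtain ⟨α, hα, hαT⟩ := exists_eq_of_forall_weight
      ((q.map φ).roots.toFinset.filter fun α => ∀ j ∈ T, ((s j).map φ).eval α = 0) (d := d)
      (((Finset.card_filter_le _ _).trans (Multiset.toFinset_card_le _)).trans
        ((card_roots' _).trans hd.le)) Tᶜ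
      (fun α j => val (((s j).map φ).eval α)) w
      (fun j hj htop => Finset.mem_compl.1 hj ((hT j).2 htop)) (fun t => by
        obtain ⟨-, -, α, hα, hT, hw⟩ := h t
        exact ⟨α, by simpa [hq] using ⟨hα, hT⟩, hw⟩)
    simp only [Finset.mem_filter, Multiset.mem_toFinset, mem_roots', IsRoot] at hα
    refine ⟨α, hα.1.2, fun j => ?_⟩
    by_cases hj : j ∈ T
    · rw [(hT j).1 hj, hα.2 j hj, val.map_zero]
    · exact hαT j (Finset.mem_compl.2 hj)

theorem definableOver_exists_root [IsAlgClosed L] (hval : Function.Surjective val)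
    (q : A[X]) {τ : Type} [Finite τ] (s : τ → A[X]) :
    DefinableOver (withCoords (specializedValues val A) τ)
      {e | q.map e.1 ≠ 0 ∧ ∃ α, (q.map e.1).eval α = 0 ∧
        ∀ j, val (((s j).map e.1).eval α) = e.2 j} := by
  obtain ⟨r, ⟨e⟩⟩ := Finite.exists_equiv_fin τ
  refine ((definableOver_exists_root_fin val hval q (s ∘ e.symm)).preimage
    (𝓕 := withCoords (specializedValues val A) τ)
    (k := fun x => (x.1, fun j => x.2 (e.symm j))) ?_).congr fun x => ?_
  · rintro _ (⟨g, hg, rfl⟩ | ⟨j, rfl⟩)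
    · exact .withCoords_fst (.of_mem hg)
    · exact .withCoords_snd _
  · simp only [mem_ofPred_eq, mem_preimage, Function.comp_apply]
    refine and_congr_right fun _ => exists_congr fun α => and_congr_right fun _ => ?_
    exact (e.symm.forall_congr_right (q := fun j => val (((s j).map x.1).eval α) = x.2 j)).symm

/-- Elimination of a field quantifier in favour of quantifiers over the value group. -/
theorem definableOver_exists_field [IsAlgClosed L] (hval : Function.Surjective val)
    {ι κ : Type} [Finite ι] [Finite κ] (q : ι → A[X]) {S : Set (ι ⊕ κ → WithTop Γ)}
    (hS : ValueDefinable S) :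
    DefinableOver (withCoords (specializedValues val A) κ)
      {e | ∃ x, Sum.elim (fun i => val (((q i).map e.1).eval x)) e.2 ∈ S} := by
  classical
  have := Fintype.ofFinite ι
  let N := (Finset.univ.sup fun i => (q i).natDegree) + 1
  have hN : ∀ i, (q i).natDegree < N := fun i =>
    Nat.lt_succ_of_le (Finset.le_sup (f := fun i => (q i).natDegree) (Finset.mem_univ i))
  -- X is added to guarantee a centre even if every q_i specializes to a polynomial without roots or
  -- to 0.
  let q' : Option ι → A[X] := fun o => o.elim X q
  let g : ι ⊕ κ → ((A →+* L) × (κ → WithTop Γ)) × ((ι × Fin N) ⊕ Unit → WithTop Γ) → WithTop Γ :=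
    Sum.elim (fun i e => Finset.univ.inf fun k : Fin N =>
      e.2 (Sum.inl (i, k)) + (k : ℕ) • e.2 (Sum.inr ())) fun k e => e.1.2 k
  have hg : ∀ c, DefinableFunOver
      (withCoords (withCoords (specializedValues val A) κ) ((ι × Fin N) ⊕ Unit)) (g c) := by
    rintro (i | k)
    · exact .finset_inf fun k => .add (.withCoords_snd _) (.nsmul (.withCoords_snd _) _)
    · exact .withCoords_fst (.withCoords_snd k)
  have hroot : ∀ o, DefinableOver
      (withCoords (withCoords (specializedValues val A) κ) ((ι × Fin N) ⊕ Unit))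
      {e | (q' o).map e.1.1 ≠ 0 ∧ ∃ α, ((q' o).map e.1.1).eval α = 0 ∧
        ∀ j : ι × Fin N, val (((hasseDeriv j.2 (q j.1)).map e.1.1).eval α) = e.2 (Sum.inl j)} := by
    intro o
    refine (definableOver_exists_root val hval (q' o)
      (fun j : ι × Fin N => hasseDeriv (j.2 : ℕ) (q j.1))).preimage
      (k := fun e : ((A →+* L) × (κ → WithTop Γ)) × ((ι × Fin N) ⊕ Unit → WithTop Γ) =>
        (e.1.1, fun j => e.2 (Sum.inl j))) ?_
    rintro _ (⟨g, hg, rfl⟩ | ⟨j, rfl⟩)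
    · exact .withCoords_fst (.withCoords_fst (.of_mem hg))
    · exact .withCoords_snd _
  refine (DefinableOver.exists_values (.exists fun o =>
    (hroot o).and (DefinableOver.subst hg hS))).congr fun ⟨φ, e⟩ => ?_
  simp only [mem_ofPred_eq]
  -- Once the Taylor expansions at α take their expected values at y, the values at y + α depend
  -- only on val y and the values of the Hasse derivatives at α.
  have hmain : ∀ α y : L, (∀ i k, val ((taylor α ((q i).map φ)).eval y) ≤
        val ((taylor α ((q i).map φ)).coeff k) + k • val y) →
      (Sum.elim (fun i => val (((q i).map φ).eval (y + α))) e : ι ⊕ κ → WithTop Γ) =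
        fun c => g c ((φ, e), Sum.elim
          (fun j : ι × Fin N => val (((hasseDeriv j.2 (q j.1)).map φ).eval α))
          fun _ => val y) := by
    intro α y h
    funext c
    rcases c with i | k
    · simp only [Sum.elim_inl, g]
      rw [← taylor_eval, val_eval_eq_inf val (h i) (N := N)
        (by rw [natDegree_taylor]; exact natDegree_map_le.trans_lt (hN i))]
      simp only [taylor_coeff, ← map_hasseDeriv, Sum.elim_inr]
      refine le_antisymm (Finset.le_inf fun k _ => Finset.inf_le (Finset.mem_range.2 k.2))
        (Finset.le_inf fun k hk => Finset.inf_le_of_le (Finset.mem_univ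
          (⟨k, Finset.mem_range.1 hk⟩ : Fin N)) le_rfl)
    · rfl
  constructor
  · rintro ⟨x, hx⟩
    let R : Finset L := Finset.univ.biUnion fun o => ((q' o).map φ).roots.toFinset
    have hR : ∀ z, z ∈ R ↔ ∃ o, (q' o).map φ ≠ 0 ∧ ((q' o).map φ).eval z = 0 := by
      intro z
      simp [R]
    -- A candidate root nearest to x; `val_eval_le_of_nearest_root` then applies to the expansions
    -- at α.
    obtain ⟨α, hα, hmax⟩ := R.exists_max_image (fun α => val (x - α))
      ⟨0, (hR 0).2 ⟨none, by simp [q']⟩⟩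
    obtain ⟨o, ho, hoα⟩ := (hR α).1 hα
    have h := hmain α (x - α) fun i k => by
      refine val_eval_le_of_nearest_root val _ _ (fun h0 z hz => ?_) k
      rw [taylor_eval] at hz
      rw [sub_sub, add_comm]
      refine hmax _ ((hR _).2 ⟨some i, fun h1 => h0 ?_, hz⟩)
      rw [show (q i).map φ = 0 from h1, map_zero]
    rw [sub_add_cancel] at h
    exact ⟨Sum.elim (fun j : ι × Fin N => val (((hasseDeriv j.2 (q j.1)).map φ).eval α))
      fun _ => val (x - α), o, ⟨ho, α, hoα, fun _ => rfl⟩, h ▸ hx⟩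
  · rintro ⟨w, o, ⟨ho, α, hoα, hw⟩, hS⟩
    -- No original x is available here: a generic y of the prescribed value realises the same
    -- minima.
    obtain ⟨y, hy, hyk⟩ := exists_generic val hval (fun i => taylor α ((q i).map φ))
      (w (Sum.inr ()))
    refine ⟨y + α, ?_⟩
    rw [hmain α y (by simpa [hy] using hyk)]
    convert hS using 5 with c
    funext j
    rcases j with j | ⟨⟩
    · exact hw j
    · exact hy

end Elimination

section Translation

set_option linter.unusedSectionVars false

variable {Γ : Type*} [AddCommGroup Γ] [LinearOrder Γ] [IsOrderedAddMonoid Γ]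

/-! ### Definability in the value group with and without infinity -/

theorem valueDefinableFun_untop {α : Type} (i : α) :
    ValueDefinableFun (fun w : α → WithTop Γ => (((w i).untopD 0 : Γ) : WithTop Γ)) := by
  classical
  have := DefinableFun.ite (valueDefinable_eq (Γ := Γ) (valueDefinableFun_proj i)
    valueDefinableFun_top) valueDefinableFun_zero (valueDefinableFun_proj i)
  convert! this using 2 with w
  by_cases h : w i = ⊤
  · simp [h]
  · obtain ⟨γ, hγ⟩ := WithTop.ne_top_iff_exists.1 h
    simp [← hγ]

theorem ValueDefinableFun.neg {α : Type} {f : (α → WithTop Γ) → Γ}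
    (hf : ValueDefinableFun fun w => (f w : WithTop Γ)) :
    ValueDefinableFun fun w => ((-f w : Γ) : WithTop Γ) := by
  have h : (fun w : α → WithTop Γ => ((-f w : Γ) : WithTop Γ)).tupleGraph =
      {z | ((f fun a => z (some a) : Γ) : WithTop Γ) + z none = 0} := by
    ext z
    simp only [Function.tupleGraph, mem_ofPred_eq]
    change _ = z none ↔ ((f (z ∘ some) : Γ) : WithTop Γ) + z none = 0
    by_cases h : z none = ⊤
    · simp [h]
    · obtain ⟨γ, hγ⟩ := WithTop.ne_top_iff_exists.1 h
      rw [← hγ, ← WithTop.coe_zero]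
      rw [← WithTop.coe_add, WithTop.coe_inj, WithTop.coe_inj, neg_eq_iff_add_eq_zero]
  rw [ValueDefinableFun, DefinableFun, h]
  exact valueDefinable_eq ((hf.comp_left some).add (valueDefinableFun_proj none))
    valueDefinableFun_zero

theorem valueDefinableFun_term {α : Type} (t : orderedGroupLanguage.Term α) :
    ValueDefinableFun fun w : α → WithTop Γ =>
      ((t.realize fun i => (w i).untopD 0 : Γ) : WithTop Γ) := by
  induction t with
  | var i => exact valueDefinableFun_untop i
  | @func n f ts ih =>
    cases f with
    | zero => exact valueDefinableFun_zero
    | neg => exact (ih 0).neg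
    | add => exact (ih 0).add (ih 1)

/-- Reading ∞ as 0 maps Γ ∪ {∞} onto Γ, so a quantifier over Γ may range over Γ ∪ {∞} instead. -/
theorem valueDefinable_of_definable {α : Type} {Y : Set (α → Γ)}
    (hY : (∅ : Set Γ).Definable orderedGroupLanguage Y) :
    ValueDefinable {w : α → WithTop Γ | (fun i => (w i).untopD 0) ∈ Y} := by
  have key : ∀ {n : ℕ} (φ : orderedGroupLanguage.BoundedFormula α n),
      ValueDefinable {z : α ⊕ Fin n → WithTop Γ |
        φ.Realize (fun i => (z (Sum.inl i)).untopD 0) fun i => (z (Sum.inr i)).untopD 0} := by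
    intro n φ
    have hterm : ∀ {n : ℕ} (t : orderedGroupLanguage.Term (α ⊕ Fin n)),
        ValueDefinableFun fun z : α ⊕ Fin n → WithTop Γ =>
          ((t.realize (Sum.elim (fun i => (z (Sum.inl i)).untopD 0)
            fun i => (z (Sum.inr i)).untopD 0) : Γ) : WithTop Γ) := by
      intro n t
      have := valueDefinableFun_term (Γ := Γ) t
      convert! this using 3
      congr 1
      ext (i | i) <;> rfl
    induction φ with
    | falsum => exact definable_empty
    | equal t₁ t₂ =>
      simpa only [WithTop.coe_inj] using! valueDefinable_eq (hterm t₁) (hterm t₂)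
    | rel R ts =>
      cases R with
      | le => simpa only [WithTop.coe_le_coe] using! valueDefinable_le' (hterm (ts 0)) (hterm (ts 1))
    | imp φ ψ h₁ h₂ =>
      convert! h₁.compl.union h₂ using 1
      ext z
      simp only [BoundedFormula.realize_imp, mem_ofPred_eq, mem_union, mem_compl_iff]
      tauto
    | @all n φ h =>
      let f : α ⊕ Fin (n + 1) → Option (α ⊕ Fin n) :=
        Sum.elim (fun a => some (Sum.inl a)) (Fin.snoc (fun i => some (Sum.inr i)) none)
      have hf : ∀ (z : α ⊕ Fin n → WithTop Γ) (m : WithTop Γ),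
          (fun i => (((fun o : Option (α ⊕ Fin n) => o.elim m z) ∘ f) (Sum.inr i)).untopD 0) =
            Fin.snoc (α := fun _ => Γ) (fun i => (z (Sum.inr i)).untopD 0) (m.untopD 0) := by
        intro z m
        ext i
        refine Fin.lastCases ?_ (fun i => ?_) i <;> simp [f]
      convert! (h.preimage_comp f).forall_option using 1
      ext z
      simp only [BoundedFormula.realize_all, mem_ofPred_eq, mem_preimage, hf]
      constructor
      · intro h m
        exact h (m.untopD 0)
      · intro h γ
        exact h γ
  obtain ⟨φ, rfl⟩ := empty_definable_iff.1 hY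
  convert! (key φ).preimage_comp (Sum.elim id finZeroElim : α ⊕ Fin 0 → α) using 1
  ext w
  simp only [mem_ofPred_eq, mem_preimage, Formula.Realize]
  rw [iff_iff_eq]
  congr 1
  exact Subsingleton.elim _ _

open Classical in
/-- The tuple in the value group with `∞` which is `∞` on `T` and `g` outside `T`. -/
noncomputable def fillTop {α : Type} (T : Set α) (g : α → Γ) : α → WithTop Γ :=
  fun i => if i ∈ T then ⊤ else (g i : WithTop Γ)

theorem fillTop_of_mem {α : Type} {T : Set α} {i : α} (hi : i ∈ T) (g : α → Γ) :
    fillTop T g i = ⊤ := if_pos hi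

theorem fillTop_of_notMem {α : Type} {T : Set α} {i : α} (hi : i ∉ T) (g : α → Γ) :
    fillTop T g i = g i := if_neg hi

theorem definable_group_eq_zero {α : Type} (i : α) :
    (∅ : Set Γ).Definable orderedGroupLanguage {g : α → Γ | g i = 0} := by
  refine empty_definable_iff.2 ⟨(Term.var i).equal
    (Term.func (L := orderedGroupLanguage) OrderedGroupFunc.zero Fin.elim0), ?_⟩
  ext g
  simp only [mem_ofPred_eq, Formula.realize_equal]
  exact Iff.rfl

theorem definable_group_add {α : Type} (i j k : α) :
    (∅ : Set Γ).Definable orderedGroupLanguage {g : α → Γ | g i + g j = g k} := by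
  refine empty_definable_iff.2 ⟨(Term.func (L := orderedGroupLanguage) OrderedGroupFunc.add
    ![Term.var i, Term.var j]).equal (Term.var k), ?_⟩
  ext g
  simp only [mem_ofPred_eq, Formula.realize_equal]
  exact Iff.rfl

theorem definable_group_le {α : Type} (i j : α) :
    (∅ : Set Γ).Definable orderedGroupLanguage {g : α → Γ | g i ≤ g j} := by
  refine empty_definable_iff.2 ⟨Relations.formula (L := orderedGroupLanguage)
    (n := 2) OrderedGroupRel.le ![Term.var i, Term.var j], ?_⟩
  ext g
  simp only [mem_ofPred_eq]
  exact Iff.rfl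

theorem definable_group_eq {α : Type} (i j : α) :
    (∅ : Set Γ).Definable orderedGroupLanguage {g : α → Γ | g i = g j} := by
  refine empty_definable_iff.2 ⟨(Term.var i).equal (Term.var j), ?_⟩
  ext g
  simp

/-- Once the infinite coordinates are fixed, an atomic formula is either decided or a formula about
the group. A universal quantifier splits into the new variable being ∞, which enlarges T, and its
ranging over Γ. -/
theorem definable_fillTop {α : Type} {S : Set (α → WithTop Γ)} (hS : ValueDefinable S)
    (T : Set α) : (∅ : Set Γ).Definable orderedGroupLanguage {g : α → Γ | fillTop T g ∈ S} := by
  classical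
  refine definable_induction_of_relational (M := WithTop Γ) (𝓛 := extendedGroupLanguage)
    (P := fun {α} S => ∀ T : Set α, (∅ : Set Γ).Definable orderedGroupLanguage
      {g : α → Γ | fillTop T g ∈ S}) ?_ ?_ ?_ ?_ ?_ ?_ hS T
  · intro α n R f T
    cases R with
    | zero =>
      change Definable _ _ {g : α → Γ | fillTop T g (f 0) = 0}
      by_cases h : f 0 ∈ T
      · simp [fillTop_of_mem h]
      · simpa [fillTop_of_notMem h] using! definable_group_eq_zero (f 0)
    | top =>
      change Definable _ _ {g : α → Γ | fillTop T g (f 0) = ⊤}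
      by_cases h : f 0 ∈ T
      · simp [fillTop_of_mem h]
      · simp [fillTop_of_notMem h]
    | add =>
      change Definable _ _ {g : α → Γ | fillTop T g (f 0) + fillTop T g (f 1) = fillTop T g (f 2)}
      by_cases h : f 0 ∈ T <;> by_cases h' : f 1 ∈ T <;> by_cases h'' : f 2 ∈ T <;>
        simp [fillTop_of_mem, fillTop_of_notMem, h, h', h'', ← WithTop.coe_add,
          definable_group_add]
    | le =>
      change Definable _ _ {g : α → Γ | fillTop T g (f 0) ≤ fillTop T g (f 1)}
      by_cases h : f 0 ∈ T <;> by_cases h' : f 1 ∈ T <;>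
        simp [fillTop_of_mem, fillTop_of_notMem, h, h', definable_group_le]
  · intro α i j T
    by_cases h : i ∈ T <;> by_cases h' : j ∈ T <;>
      simp [fillTop_of_mem, fillTop_of_notMem, h, h', definable_group_eq]
  · intro α T
    simp
  · intro α S S' hS hS' T
    exact (hS T).compl.union (hS' T)
  · intro α S hS T
    have h1 : ∀ (g : α → Γ) (γ : Γ), fillTop (insert none (some '' T))
        (fun o => o.elim γ g) = fun o => o.elim ⊤ (fillTop T g) := by
      intro g γ
      ext o
      rcases o with _ | i
      · simp [fillTop]
      · by_cases h : i ∈ T <;> simp [fillTop, h]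
    have h2 : ∀ (g : α → Γ) (γ : Γ), fillTop (some '' T)
        (fun o => o.elim γ g) = fun o => o.elim (γ : WithTop Γ) (fillTop T g) := by
      intro g γ
      ext o
      rcases o with _ | i
      · simp [fillTop]
      · by_cases h : i ∈ T <;> simp [fillTop, h]
    convert! (hS (insert none (some '' T))).forall_option.inter
      (hS (some '' T)).forall_option using 1
    ext g
    simp only [mem_ofPred_eq, mem_inter_iff, h1, h2, forall_const, WithTop.forall]
  · intro α β f S hS T
    exact (hS (f ⁻¹' T)).preimage_comp f

end Translation

/-! ### Relative quantifier elimination in the two-sorted structure -/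

section TwoSortedDefinable

set_option linter.unusedSectionVars false

variable {L : Type*} [Field L] {Γ : Type*} [AddCommGroup Γ] [LinearOrder Γ]
  [IsOrderedAddMonoid Γ] {val : AddValuation L (WithTop Γ)}

namespace TwoSorted

theorem cases (x : TwoSorted val) : (∃ a, x = ofField val a) ∨ ∃ γ, x = ofValue val γ := by
  rcases x with a | γ
  · exact Or.inl ⟨a, rfl⟩
  · exact Or.inr ⟨γ, rfl⟩

/-- The field element underlying an element of the two-sorted structure (`0` for values). -/
def fieldPart : TwoSorted val → L := Sum.elim id fun _ => 0

/-- The value underlying an element of the two-sorted structure (`0` for field elements). -/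
def valuePart : TwoSorted val → WithTop Γ := Sum.elim (fun _ => 0) id

/-- The sort of an element, coded by `0` for field elements and `∞` for values. -/
def sortCode : TwoSorted val → WithTop Γ := Sum.elim (fun _ => 0) fun _ => ⊤

@[simp] theorem fieldPart_ofField (a : L) : fieldPart (ofField val a) = a := rfl
@[simp] theorem fieldPart_ofValue (γ : WithTop Γ) : fieldPart (ofValue val γ) = 0 := rfl
@[simp] theorem valuePart_ofField (a : L) : valuePart (ofField val a) = 0 := rfl
@[simp] theorem valuePart_ofValue (γ : WithTop Γ) : valuePart (ofValue val γ) = γ := rfl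
@[simp] theorem sortCode_ofField (a : L) : sortCode (ofField val a) = 0 := rfl
@[simp] theorem sortCode_ofValue (γ : WithTop Γ) : sortCode (ofValue val γ) = ⊤ := rfl

@[simp] theorem ofField_inj {a b : L} : ofField val a = ofField val b ↔ a = b := Sum.inl_injective.eq_iff
@[simp] theorem ofValue_inj {a b : WithTop Γ} : ofValue val a = ofValue val b ↔ a = b :=
  Sum.inr_injective.eq_iff
@[simp] theorem ofField_ne_ofValue (a : L) (γ : WithTop Γ) : ofField val a ≠ ofValue val γ :=
  Sum.inl_ne_inr
@[simp] theorem ofValue_ne_ofField (a : L) (γ : WithTop Γ) : ofValue val γ ≠ ofField val a :=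
  Sum.inr_ne_inl

end TwoSorted

open TwoSorted

variable (val) in
/-- The basic functions from tuples of the two-sorted structure to the value group with `∞`. -/
def twoSortedFamily (α : Type) : Set ((α → TwoSorted val) → WithTop Γ) :=
  {f | (∃ p : MvPolynomial α ℤ, f = fun x => val (MvPolynomial.aeval (fun i => fieldPart (x i)) p)) ∨
    (∃ i, f = fun x => valuePart (x i)) ∨ ∃ i, f = fun x => sortCode (x i)}

theorem definableFunOver_aeval {α : Type} (p : MvPolynomial α ℤ) :
    DefinableFunOver (twoSortedFamily val α)
      (fun x => val (MvPolynomial.aeval (fun i => fieldPart (x i)) p)) := .of_mem (Or.inl ⟨p, rfl⟩)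

theorem definableFunOver_valuePart {α : Type} (i : α) :
    DefinableFunOver (twoSortedFamily val α) (fun x => valuePart (x i)) :=
  .of_mem (Or.inr (Or.inl ⟨i, rfl⟩))

theorem definableFunOver_sortCode {α : Type} (i : α) :
    DefinableFunOver (twoSortedFamily val α) (fun x => sortCode (x i)) :=
  .of_mem (Or.inr (Or.inr ⟨i, rfl⟩))

theorem definableOver_aeval_eq_zero {α : Type} (p : MvPolynomial α ℤ) :
    DefinableOver (twoSortedFamily val α)
      {x | MvPolynomial.aeval (fun i => fieldPart (x i)) p = 0} :=
  (DefinableOver.eq_top (definableFunOver_aeval p)).congr fun x => by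
    simp [val.top_iff]

theorem definableOver_isField {α : Type} (i : α) :
    DefinableOver (twoSortedFamily val α) {x | sortCode (x i) = 0} :=
  .eq (definableFunOver_sortCode i) .zero

theorem definableOver_isValue {α : Type} (i : α) :
    DefinableOver (twoSortedFamily val α) {x | sortCode (x i) = ⊤} :=
  .eq (definableFunOver_sortCode i) .top

open MvPolynomial in
theorem definableOver_relMap {α : Type} {n : ℕ} (R : valuedFieldLanguage.Relations n)
    (f : Fin n → α) :
    DefinableOver (twoSortedFamily val α)
      {x : α → TwoSorted val | Structure.RelMap R (x ∘ f)} := by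
  cases R with
  | fieldSort =>
    refine (definableOver_isField (f 0)).congr fun x => ?_
    change (∃ a, x (f 0) = ofField val a) ↔ sortCode (x (f 0)) = 0
    rcases (x (f 0)).cases with ⟨a, h⟩ | ⟨a, h⟩ <;> simp [h]
  | valueSort =>
    refine (definableOver_isValue (f 0)).congr fun x => ?_
    change (∃ a, x (f 0) = ofValue val a) ↔ sortCode (x (f 0)) = ⊤
    rcases (x (f 0)).cases with ⟨a, h⟩ | ⟨a, h⟩ <;> simp [h]
  | fieldZero =>
    refine ((definableOver_isField (f 0)).and
      (definableOver_aeval_eq_zero (X (f 0)))).congr fun x => ?_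
    change x (f 0) = ofField val 0 ↔ sortCode (x (f 0)) = 0 ∧ aeval _ _ = 0
    rw [aeval_X]
    rcases (x (f 0)).cases with ⟨a, h⟩ | ⟨a, h⟩ <;> simp [h]
  | fieldOne =>
    refine ((definableOver_isField (f 0)).and
      (definableOver_aeval_eq_zero (X (f 0) - 1))).congr fun x => ?_
    change x (f 0) = ofField val 1 ↔ sortCode (x (f 0)) = 0 ∧ aeval _ _ = 0
    rw [map_sub, map_one, aeval_X, sub_eq_zero]
    rcases (x (f 0)).cases with ⟨a, h⟩ | ⟨a, h⟩ <;> simp [h]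
  | fieldNeg =>
    refine ((definableOver_isField (f 0)).and ((definableOver_isField (f 1)).and
      (definableOver_aeval_eq_zero (X (f 1) + X (f 0))))).congr fun x => ?_
    change (∃ a, x (f 0) = ofField val a ∧ x (f 1) = ofField val (-a)) ↔
      sortCode (x (f 0)) = 0 ∧ sortCode (x (f 1)) = 0 ∧ aeval _ _ = 0
    rw [map_add, aeval_X, aeval_X, add_eq_zero_iff_eq_neg]
    rcases (x (f 0)).cases with ⟨a, h⟩ | ⟨a, h⟩ <;>
      rcases (x (f 1)).cases with ⟨b, h'⟩ | ⟨b, h'⟩ <;> simp [h, h']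
  | fieldAdd =>
    refine ((definableOver_isField (f 0)).and ((definableOver_isField (f 1)).and
      ((definableOver_isField (f 2)).and
      (definableOver_aeval_eq_zero (X (f 2) - (X (f 0) + X (f 1))))))).congr fun x => ?_
    change (∃ a b, x (f 0) = ofField val a ∧ x (f 1) = ofField val b ∧
      x (f 2) = ofField val (a + b)) ↔
      sortCode (x (f 0)) = 0 ∧ sortCode (x (f 1)) = 0 ∧ sortCode (x (f 2)) = 0 ∧ aeval _ _ = 0
    rw [map_sub, map_add, aeval_X, aeval_X, aeval_X, sub_eq_zero]
    rcases (x (f 0)).cases with ⟨a, h⟩ | ⟨a, h⟩ <;>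
      rcases (x (f 1)).cases with ⟨b, h'⟩ | ⟨b, h'⟩ <;>
      rcases (x (f 2)).cases with ⟨c, h''⟩ | ⟨c, h''⟩ <;> simp [h, h', h'']
  | fieldMul =>
    refine ((definableOver_isField (f 0)).and ((definableOver_isField (f 1)).and
      ((definableOver_isField (f 2)).and
      (definableOver_aeval_eq_zero (X (f 2) - X (f 0) * X (f 1)))))).congr fun x => ?_
    change (∃ a b, x (f 0) = ofField val a ∧ x (f 1) = ofField val b ∧
      x (f 2) = ofField val (a * b)) ↔
      sortCode (x (f 0)) = 0 ∧ sortCode (x (f 1)) = 0 ∧ sortCode (x (f 2)) = 0 ∧ aeval _ _ = 0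
    rw [map_sub, map_mul, aeval_X, aeval_X, aeval_X, sub_eq_zero]
    rcases (x (f 0)).cases with ⟨a, h⟩ | ⟨a, h⟩ <;>
      rcases (x (f 1)).cases with ⟨b, h'⟩ | ⟨b, h'⟩ <;>
      rcases (x (f 2)).cases with ⟨c, h''⟩ | ⟨c, h''⟩ <;> simp [h, h', h'']
  | valueZero =>
    refine ((definableOver_isValue (f 0)).and
      (.eq (definableFunOver_valuePart (f 0)) .zero)).congr fun x => ?_
    change x (f 0) = ofValue val 0 ↔ sortCode (x (f 0)) = ⊤ ∧ valuePart (x (f 0)) = 0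
    rcases (x (f 0)).cases with ⟨a, h⟩ | ⟨a, h⟩ <;> simp [h]
  | valueTop =>
    refine ((definableOver_isValue (f 0)).and
      (.eq (definableFunOver_valuePart (f 0)) .top)).congr fun x => ?_
    change x (f 0) = ofValue val ⊤ ↔ sortCode (x (f 0)) = ⊤ ∧ valuePart (x (f 0)) = ⊤
    rcases (x (f 0)).cases with ⟨a, h⟩ | ⟨a, h⟩ <;> simp [h]
  | valueNeg =>
    refine ((definableOver_isValue (f 0)).and ((definableOver_isValue (f 1)).and
      (.eq (.add (definableFunOver_valuePart (f 1)) (definableFunOver_valuePart (f 0)))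
        .zero))).congr fun x => ?_
    change (∃ γ : Γ, x (f 0) = ofValue val γ ∧ x (f 1) = ofValue val ((-γ : Γ) : WithTop Γ)) ↔
      sortCode (x (f 0)) = ⊤ ∧ sortCode (x (f 1)) = ⊤ ∧
        valuePart (x (f 1)) + valuePart (x (f 0)) = 0
    rcases (x (f 0)).cases with ⟨a, h⟩ | ⟨a, h⟩ <;>
      rcases (x (f 1)).cases with ⟨b, h'⟩ | ⟨b, h'⟩ <;>
        simp [h, h', -WithTop.LinearOrderedAddCommGroup.coe_neg]
    by_cases ha : a = ⊤
    · simp [ha]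
    by_cases hb : b = ⊤
    · simp [hb, -WithTop.LinearOrderedAddCommGroup.coe_neg]
    obtain ⟨γ, rfl⟩ := WithTop.ne_top_iff_exists.1 ha
    obtain ⟨δ, rfl⟩ := WithTop.ne_top_iff_exists.1 hb
    rw [← WithTop.coe_add, ← WithTop.coe_zero, WithTop.coe_inj, add_eq_zero_iff_eq_neg]
    simp [WithTop.coe_inj, -WithTop.LinearOrderedAddCommGroup.coe_neg]
  | valueAdd =>
    refine ((definableOver_isValue (f 0)).and ((definableOver_isValue (f 1)).and
      ((definableOver_isValue (f 2)).and
      (.eq (definableFunOver_valuePart (f 2)) (.add (definableFunOver_valuePart (f 0))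
        (definableFunOver_valuePart (f 1))))))).congr fun x => ?_
    change (∃ a b, x (f 0) = ofValue val a ∧ x (f 1) = ofValue val b ∧
      x (f 2) = ofValue val (a + b)) ↔
      sortCode (x (f 0)) = ⊤ ∧ sortCode (x (f 1)) = ⊤ ∧ sortCode (x (f 2)) = ⊤ ∧
        valuePart (x (f 2)) = valuePart (x (f 0)) + valuePart (x (f 1))
    rcases (x (f 0)).cases with ⟨a, h⟩ | ⟨a, h⟩ <;>
      rcases (x (f 1)).cases with ⟨b, h'⟩ | ⟨b, h'⟩ <;>
      rcases (x (f 2)).cases with ⟨c, h''⟩ | ⟨c, h''⟩ <;> simp [h, h', h'']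
  | valueLE =>
    refine ((definableOver_isValue (f 0)).and ((definableOver_isValue (f 1)).and
      (.le (definableFunOver_valuePart (f 0)) (definableFunOver_valuePart (f 1))))).congr
      fun x => ?_
    change (∃ a b, x (f 0) = ofValue val a ∧ x (f 1) = ofValue val b ∧ a ≤ b) ↔
      sortCode (x (f 0)) = ⊤ ∧ sortCode (x (f 1)) = ⊤ ∧ valuePart (x (f 0)) ≤ valuePart (x (f 1))
    rcases (x (f 0)).cases with ⟨a, h⟩ | ⟨a, h⟩ <;>
      rcases (x (f 1)).cases with ⟨b, h'⟩ | ⟨b, h'⟩ <;> simp [h, h']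
  | val =>
    refine ((definableOver_isField (f 0)).and ((definableOver_isValue (f 1)).and
      (.eq (definableFunOver_valuePart (f 1)) (definableFunOver_aeval (X (f 0)))))).congr
      fun x => ?_
    change (∃ a, x (f 0) = ofField val a ∧ x (f 1) = ofValue val (val a)) ↔
      sortCode (x (f 0)) = 0 ∧ sortCode (x (f 1)) = ⊤ ∧ valuePart (x (f 1)) = val (aeval _ _)
    rw [aeval_X]
    rcases (x (f 0)).cases with ⟨a, h⟩ | ⟨a, h⟩ <;>
      rcases (x (f 1)).cases with ⟨b, h'⟩ | ⟨b, h'⟩ <;> simp [h, h']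

open MvPolynomial in
theorem definableOver_coord_eq {α : Type} (i j : α) :
    DefinableOver (twoSortedFamily val α) {x : α → TwoSorted val | x i = x j} := by
  refine ((DefinableOver.eq (definableFunOver_sortCode i) (definableFunOver_sortCode j)).and
    ((DefinableOver.eq (definableFunOver_valuePart i) (definableFunOver_valuePart j)).and
    (definableOver_aeval_eq_zero (X i - X j)))).congr fun x => ?_
  change _ ↔ sortCode (x i) = sortCode (x j) ∧ valuePart (x i) = valuePart (x j) ∧ aeval _ _ = 0
  rw [map_sub, aeval_X, aeval_X, sub_eq_zero]
  change x i = x j ↔ _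
  rcases (x i).cases with ⟨a, h⟩ | ⟨a, h⟩ <;>
    rcases (x j).cases with ⟨b, h'⟩ | ⟨b, h'⟩ <;> simp [h, h']

open MvPolynomial in
theorem definableOver_comp {α β : Type} (f : α → β) {D : Set (α → TwoSorted val)}
    (hD : DefinableOver (twoSortedFamily val α) D) :
    DefinableOver (twoSortedFamily val β) {x : β → TwoSorted val | x ∘ f ∈ D} := by
  refine hD.preimage (k := fun x => x ∘ f) ?_
  rintro _ (⟨p, rfl⟩ | ⟨i, rfl⟩ | ⟨i, rfl⟩)
  · convert! definableFunOver_aeval (val := val) (rename f p) using 3 with x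
    rw [aeval_rename]
    rfl
  · exact definableFunOver_valuePart (f i)
  · exact definableFunOver_sortCode (f i)

open MvPolynomial in
theorem definableOver_exists_value {α : Type} {D : Set (Option α → TwoSorted val)}
    (hD : DefinableOver (twoSortedFamily val (Option α)) D) :
    DefinableOver (twoSortedFamily val α)
      {x | ∃ γ, (fun o : Option α => o.elim (ofValue val γ) x) ∈ D} := by
  refine (DefinableOver.exists_values (κ := Unit) (hD.preimage
    (k := fun e o => o.elim (ofValue val (e.2 ())) e.1) ?_)).congr fun x => ?_
  · rintro _ (⟨p, rfl⟩ | ⟨i, rfl⟩ | ⟨i, rfl⟩)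
    -- A value has field part 0, so the new variable of the polynomial is set to 0.
    · convert! DefinableFunOver.withCoords_fst (κ := Unit) (definableFunOver_aeval (val := val)
        (aeval (fun o : Option α => o.elim 0 X) p : MvPolynomial α ℤ)) using 2 with e
      simp only [Function.comp_apply]
      congr 1
      induction p using MvPolynomial.induction_on with
      | C a => simp
      | add p q hp hq => simp only [map_add, hp, hq]
      | mul_X p i hp =>
        rcases i with _ | i <;> simp [hp]
    · rcases i with _ | i
      · exact .withCoords_snd ()
      · exact .withCoords_fst (definableFunOver_valuePart i)
    · rcases i with _ | i
      · exact .top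
      · exact .withCoords_fst (definableFunOver_sortCode i)
  · simp only [mem_ofPred_eq, mem_preimage]
    exact ⟨fun ⟨γ, h⟩ => ⟨fun _ => γ, h⟩, fun ⟨w, h⟩ => ⟨w (), h⟩⟩

open MvPolynomial in
theorem definableOver_exists_fieldElement [IsAlgClosed L] (hval : Function.Surjective val)
    {α : Type} {D : Set (Option α → TwoSorted val)}
    (hD : DefinableOver (twoSortedFamily val (Option α)) D) :
    DefinableOver (twoSortedFamily val α)
      {x | ∃ a, (fun o : Option α => o.elim (ofField val a) x) ∈ D} := by
  obtain ⟨ι, _, f, S, hf, hS, rfl⟩ := hD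
  -- Each basic function is either the value of a polynomial in the new variable `a`, with
  -- coefficients specialized at x, or independent of `a`. The tag `c` records the case, and its
  -- defining equation keeps the index `i`.
  have hsplit : ∀ i, ∃ (c : ι ⊕ ι) (q : Polynomial (MvPolynomial α ℤ))
      (h : (α → TwoSorted val) → WithTop Γ), DefinableFunOver (twoSortedFamily val α) h ∧
      c = c.elim (fun _ => Sum.inl i) (fun _ => Sum.inr i) ∧
      ∀ (x : α → TwoSorted val) a, f i (fun o : Option α => o.elim (ofField val a) x) =
        c.elim (fun _ => val ((q.map (aeval fun i => fieldPart (x i) :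
          MvPolynomial α ℤ →ₐ[ℤ] L).toRingHom).eval a)) (fun _ => h x) := by
    intro i
    rcases hf i with ⟨p, hp⟩ | ⟨o, ho⟩ | ⟨o, ho⟩
    · refine ⟨Sum.inl i, optionEquivLeft ℤ α p, fun _ => 0, .zero, rfl, fun x a => ?_⟩
      rw [hp]
      simp only [Sum.elim_inl]
      congr 1
      clear hp
      induction p using MvPolynomial.induction_on with
      | C a => simp
      | add p q hp hq => simp only [map_add, Polynomial.map_add, Polynomial.eval_add, hp, hq]
      | mul_X p i hp =>
        rw [map_mul, hp, map_mul, Polynomial.map_mul, Polynomial.eval_mul]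
        rcases i with _ | i <;> simp
    · rcases o with _ | o
      · exact ⟨Sum.inr i, 0, fun _ => 0, .zero, rfl, fun x a => by rw [ho]; rfl⟩
      · exact ⟨Sum.inr i, 0, _, definableFunOver_valuePart o, rfl, fun x a => by rw [ho]; rfl⟩
    · rcases o with _ | o
      · exact ⟨Sum.inr i, 0, fun _ => 0, .zero, rfl, fun x a => by rw [ho]; rfl⟩
      · exact ⟨Sum.inr i, 0, _, definableFunOver_sortCode o, rfl, fun x a => by rw [ho]; rfl⟩
  choose c q h hh hc hfc using hsplit
  refine ((definableOver_exists_field val hval q (κ := ι) (hS.preimage_comp c)).preimage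
    (𝓕 := twoSortedFamily val α)
    (k := fun x => ((aeval fun i => fieldPart (x i) : MvPolynomial α ℤ →ₐ[ℤ] L).toRingHom,
      fun i => h i x)) ?_).congr fun x => ?_
  · rintro _ (⟨_, ⟨p, rfl⟩, rfl⟩ | ⟨i, rfl⟩)
    · exact definableFunOver_aeval p
    · exact hh i
  · simp only [mem_ofPred_eq, mem_preimage, hfc]
    refine exists_congr fun a => ?_
    have : ∀ i, (c i).elim (fun _ => val (((q i).map (aeval fun i => fieldPart (x i) :
          MvPolynomial α ℤ →ₐ[ℤ] L).toRingHom).eval a)) (fun _ => h i x) =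
        Sum.elim (fun i => val (((q i).map (aeval fun i => fieldPart (x i) :
          MvPolynomial α ℤ →ₐ[ℤ] L).toRingHom).eval a)) (fun i => h i x) (c i) := by
      intro i
      rcases hci : c i with j | j
      · have := hc i
        rw [hci] at this
        simp only [Sum.elim_inl, Sum.inl.injEq] at this
        rw [this]; rfl
      · have := hc i
        rw [hci] at this
        simp only [Sum.elim_inr, Sum.inr.injEq] at this
        rw [this]; rfl
    simp only [this]
    rfl

/-- Quantifier elimination relative to the value group for algebraically closed valued fields. -/
theorem definableOver_of_definable [IsAlgClosed L] (hval : Function.Surjective val)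
    {α : Type} {D : Set (α → TwoSorted val)}
    (hD : (∅ : Set (TwoSorted val)).Definable valuedFieldLanguage D) :
    DefinableOver (twoSortedFamily val α) D := by
  refine definable_induction_of_relational
    (P := fun {α} D => DefinableOver (twoSortedFamily val α) D)
    definableOver_relMap definableOver_coord_eq .empty (fun h h' => h.compl.union h')
    (fun {α D} h => ?_) (fun f _ h => definableOver_comp f h) hD
  refine ((definableOver_exists_fieldElement hval h.compl).union
    (definableOver_exists_value h.compl)).compl.congr fun x => ?_
  simp only [mem_ofPred_eq, mem_compl_iff, mem_union, not_or, not_exists, not_not]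
  refine ⟨fun h => ⟨fun a => h _, fun γ => h _⟩, fun h m => ?_⟩
  rcases m.cases with ⟨a, rfl⟩ | ⟨γ, rfl⟩
  · exact h.1 a
  · exact h.2 γ

/-! ### Definability in the two-sorted structure -/

/-- `∅`-definable functions on the two-sorted structure. -/
abbrev TwoSortedFun {α : Type} (F : (α → TwoSorted val) → TwoSorted val) : Prop :=
  (∅ : Set (TwoSorted val)).DefinableFun valuedFieldLanguage F

theorem twoSortedFun_proj {α : Type} (i : α) :
    TwoSortedFun (fun x : α → TwoSorted val => x i) := DefinableFun.proj _

theorem definable_relMap {α : Type} {n : ℕ} (R : valuedFieldLanguage.Relations n)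
    {F : Fin n → (α → TwoSorted val) → TwoSorted val} (hF : ∀ i, TwoSortedFun (F i)) :
    (∅ : Set (TwoSorted val)).Definable valuedFieldLanguage
      {x | Structure.RelMap R (fun i => F i x)} := by
  have h : (∅ : Set (TwoSorted val)).Definable valuedFieldLanguage
      {y : Fin n → TwoSorted val | Structure.RelMap R y} := by
    refine empty_definable_iff.2 ⟨R.formula fun i => Term.var i, ?_⟩
    ext y
    simp only [mem_ofPred_eq, Formula.realize_rel]
    exact Iff.rfl
  exact h.preimage_map (F := fun x i => F i x) hF

theorem TwoSortedFun.comp_left {α β : Type} {F : (α → TwoSorted val) → TwoSorted val}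
    (hF : TwoSortedFun F) (k : α → β) :
    TwoSortedFun (fun x : β → TwoSorted val => F fun a => x (k a)) := by
  have : (fun x : β → TwoSorted val => F fun a => x (k a)).tupleGraph =
      (fun g : Option β → TwoSorted val => g ∘ Option.map k) ⁻¹' F.tupleGraph := rfl
  rw [TwoSortedFun, DefinableFun, this]
  exact Definable.preimage_comp _ hF

theorem twoSortedFun_of_graph {α : Type} {F : (α → TwoSorted val) → TwoSorted val}
    {G : Set (Option α → TwoSorted val)}
    (hG : (∅ : Set (TwoSorted val)).Definable valuedFieldLanguage G)
    (h : ∀ z, z ∈ G ↔ F (z ∘ some) = z none) : TwoSortedFun F := by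
  rw [TwoSortedFun, DefinableFun, show F.tupleGraph = G from Set.ext fun z => (h z).symm]
  exact hG

theorem definable_relMap_var {α : Type} {n : ℕ} (R : valuedFieldLanguage.Relations n)
    (f : Fin n → α) :
    (∅ : Set (TwoSorted val)).Definable valuedFieldLanguage
      {x : α → TwoSorted val | Structure.RelMap R (x ∘ f)} :=
  definable_relMap R fun i => twoSortedFun_proj (f i)

theorem twoSortedFun_fieldPart {α : Type} (i : α) :
    TwoSortedFun (fun x : α → TwoSorted val => ofField val (fieldPart (x i))) := by
  refine twoSortedFun_of_graph (((definable_relMap_var ValuedFieldRel.fieldSort ![some i]).inter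
    ((twoSortedFun_proj (some i)).ofPred_eq (twoSortedFun_proj none))).union
    ((definable_relMap_var ValuedFieldRel.valueSort ![some i]).inter
      (definable_relMap_var ValuedFieldRel.fieldZero ![none]))) fun z => ?_
  change ((∃ a, z (some i) = ofField val a) ∧ z (some i) = z none) ∨
    ((∃ a, z (some i) = ofValue val a) ∧ z none = ofField val 0) ↔
    ofField val (fieldPart (z (some i))) = z none
  rcases (z (some i)).cases with ⟨a, h⟩ | ⟨a, h⟩ <;> simp [h, eq_comm]

theorem twoSortedFun_valuePart {α : Type} (i : α) :
    TwoSortedFun (fun x : α → TwoSorted val => ofValue val (valuePart (x i))) := by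
  refine twoSortedFun_of_graph (((definable_relMap_var ValuedFieldRel.valueSort ![some i]).inter
    ((twoSortedFun_proj (some i)).ofPred_eq (twoSortedFun_proj none))).union
    ((definable_relMap_var ValuedFieldRel.fieldSort ![some i]).inter
      (definable_relMap_var ValuedFieldRel.valueZero ![none]))) fun z => ?_
  change ((∃ a, z (some i) = ofValue val a) ∧ z (some i) = z none) ∨
    ((∃ a, z (some i) = ofField val a) ∧ z none = ofValue val 0) ↔
    ofValue val (valuePart (z (some i))) = z none
  rcases (z (some i)).cases with ⟨a, h⟩ | ⟨a, h⟩ <;> simp [h, eq_comm]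

theorem twoSortedFun_sortCode {α : Type} (i : α) :
    TwoSortedFun (fun x : α → TwoSorted val => ofValue val (sortCode (x i))) := by
  refine twoSortedFun_of_graph (((definable_relMap_var ValuedFieldRel.valueSort ![some i]).inter
    (definable_relMap_var ValuedFieldRel.valueTop ![none])).union
    ((definable_relMap_var ValuedFieldRel.fieldSort ![some i]).inter
      (definable_relMap_var ValuedFieldRel.valueZero ![none]))) fun z => ?_
  change ((∃ a, z (some i) = ofValue val a) ∧ z none = ofValue val ⊤) ∨
    ((∃ a, z (some i) = ofField val a) ∧ z none = ofValue val 0) ↔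
    ofValue val (sortCode (z (some i))) = z none
  rcases (z (some i)).cases with ⟨a, h⟩ | ⟨a, h⟩ <;> simp [h, eq_comm]

/-- Field-valued functions whose embedding in the two-sorted structure is definable. -/
abbrev FieldFun {α : Type} (F : (α → TwoSorted val) → L) : Prop :=
  TwoSortedFun fun x => ofField val (F x)

theorem FieldFun.add {α : Type} {F G : (α → TwoSorted val) → L} (hF : FieldFun F)
    (hG : FieldFun G) : FieldFun fun x => F x + G x := by
  refine twoSortedFun_of_graph (definable_relMap ValuedFieldRel.fieldAdd
    (F := ![_, _, _]) (Fin.cases (hF.comp_left some) (Fin.cases (hG.comp_left some)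
      (Fin.cases (twoSortedFun_proj none) finZeroElim)))) fun z => ?_
  change (∃ a b, ofField val (F (z ∘ some)) = ofField val a ∧
    ofField val (G (z ∘ some)) = ofField val b ∧ z none = ofField val (a + b)) ↔
    ofField val (F (z ∘ some) + G (z ∘ some)) = z none
  simp [eq_comm]

theorem FieldFun.mul {α : Type} {F G : (α → TwoSorted val) → L} (hF : FieldFun F)
    (hG : FieldFun G) : FieldFun fun x => F x * G x := by
  refine twoSortedFun_of_graph (definable_relMap ValuedFieldRel.fieldMul
    (F := ![_, _, _]) (Fin.cases (hF.comp_left some) (Fin.cases (hG.comp_left some)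
      (Fin.cases (twoSortedFun_proj none) finZeroElim)))) fun z => ?_
  change (∃ a b, ofField val (F (z ∘ some)) = ofField val a ∧
    ofField val (G (z ∘ some)) = ofField val b ∧ z none = ofField val (a * b)) ↔
    ofField val (F (z ∘ some) * G (z ∘ some)) = z none
  simp [eq_comm]

theorem FieldFun.neg {α : Type} {F : (α → TwoSorted val) → L} (hF : FieldFun F) :
    FieldFun fun x => - F x := by
  refine twoSortedFun_of_graph (definable_relMap ValuedFieldRel.fieldNeg
    (F := ![_, _]) (Fin.cases (hF.comp_left some)
      (Fin.cases (twoSortedFun_proj none) finZeroElim))) fun z => ?_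
  change (∃ a, ofField val (F (z ∘ some)) = ofField val a ∧ z none = ofField val (-a)) ↔
    ofField val (-F (z ∘ some)) = z none
  simp [eq_comm]

theorem FieldFun.zero {α : Type} : FieldFun (val := val) fun _ : α → TwoSorted val => 0 :=
  twoSortedFun_of_graph (definable_relMap_var ValuedFieldRel.fieldZero ![none]) fun _ => eq_comm

theorem FieldFun.one {α : Type} : FieldFun (val := val) fun _ : α → TwoSorted val => 1 :=
  twoSortedFun_of_graph (definable_relMap_var ValuedFieldRel.fieldOne ![none]) fun _ => eq_comm

theorem FieldFun.aeval {α : Type} (p : MvPolynomial α ℤ) :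
    FieldFun fun x : α → TwoSorted val => MvPolynomial.aeval (fun i => fieldPart (x i)) p := by
  induction p using MvPolynomial.induction_on with
  | C a =>
    simp only [eq_intCast]
    induction a using Int.induction_on with
    | zero => simpa using! FieldFun.zero
    | succ n ih => simpa using! ih.add .one
    | pred n ih => simpa [sub_eq_add_neg] using! ih.add FieldFun.one.neg
  | add p q hp hq => simpa using! FieldFun.add hp hq
  | mul_X p i hp => simpa using! FieldFun.mul hp (twoSortedFun_fieldPart i)

theorem twoSortedFun_val {α : Type} {F : (α → TwoSorted val) → L} (hF : FieldFun F) :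
    TwoSortedFun fun x => ofValue val (val (F x)) := by
  refine twoSortedFun_of_graph (definable_relMap ValuedFieldRel.val
    (F := ![_, _]) (Fin.cases (hF.comp_left some)
      (Fin.cases (twoSortedFun_proj none) finZeroElim))) fun z => ?_
  change (∃ a, ofField _ (F (z ∘ some)) = ofField _ a ∧ z none = ofValue _ (_)) ↔ _
  simp [eq_comm]

/-- Every element of Γ ∪ {∞} is a `valuePart`, so quantifiers over the value sort can be traded for
quantifiers over the whole structure. -/
theorem definable_of_valueDefinable {α : Type} {S : Set (α → WithTop Γ)} (hS : ValueDefinable S) :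
    (∅ : Set (TwoSorted val)).Definable valuedFieldLanguage
      {x : α → TwoSorted val | (fun i => valuePart (x i)) ∈ S} := by
  refine definable_induction_of_relational (M := WithTop Γ) (𝓛 := extendedGroupLanguage)
    (P := fun {α} S => (∅ : Set (TwoSorted val)).Definable valuedFieldLanguage
      {x : α → TwoSorted val | (fun i => valuePart (x i)) ∈ S}) ?_ ?_ ?_ ?_ ?_ ?_ hS
  · intro α n R f
    cases R with
    | zero =>
      convert! definable_relMap (val := val) ValuedFieldRel.valueZero (F := ![_])
        (Fin.cases (twoSortedFun_valuePart (f 0)) finZeroElim) using 1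
      ext x
      change valuePart (x (f 0)) = 0 ↔ ofValue val (valuePart (x (f 0))) = ofValue val 0
      simp
    | top =>
      convert! definable_relMap (val := val) ValuedFieldRel.valueTop (F := ![_])
        (Fin.cases (twoSortedFun_valuePart (f 0)) finZeroElim) using 1
      ext x
      change valuePart (x (f 0)) = ⊤ ↔ ofValue val (valuePart (x (f 0))) = ofValue val ⊤
      simp
    | add =>
      convert! definable_relMap (val := val) ValuedFieldRel.valueAdd (F := ![_, _, _])
        (Fin.cases (twoSortedFun_valuePart (f 0)) (Fin.cases (twoSortedFun_valuePart (f 1))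
          (Fin.cases (twoSortedFun_valuePart (f 2)) finZeroElim))) using 1
      ext x
      change valuePart (x (f 0)) + valuePart (x (f 1)) = valuePart (x (f 2)) ↔
        ∃ a b, ofValue val (valuePart (x (f 0))) = ofValue val a ∧
        ofValue val (valuePart (x (f 1))) = ofValue val b ∧
        ofValue val (valuePart (x (f 2))) = ofValue val (a + b)
      simp [eq_comm]
    | le =>
      convert! definable_relMap (val := val) ValuedFieldRel.valueLE (F := ![_, _])
        (Fin.cases (twoSortedFun_valuePart (f 0)) (Fin.cases (twoSortedFun_valuePart (f 1))
          finZeroElim)) using 1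
      ext x
      change valuePart (x (f 0)) ≤ valuePart (x (f 1)) ↔
        ∃ a b, ofValue val (valuePart (x (f 0))) = ofValue val a ∧
        ofValue val (valuePart (x (f 1))) = ofValue val b ∧ a ≤ b
      simp
  · intro α i j
    convert! (twoSortedFun_valuePart (val := val) i).ofPred_eq (twoSortedFun_valuePart j) using 1
    ext x
    simp
  · intro α
    exact definable_empty
  · intro α S T h h'
    exact h.compl.union h'
  · intro α S h
    convert! h.forall_option using 1
    ext x
    simp only [mem_ofPred_eq]
    have : ∀ m : TwoSorted val, (fun i : Option α => valuePart (i.elim m x)) =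
        fun o => o.elim (valuePart m) fun i => valuePart (x i) := by
      intro m
      ext o
      cases o <;> rfl
    simp only [this]
    exact ⟨fun h m => h _, fun h γ => h (ofValue val γ)⟩
  · intro α β f S h
    exact h.preimage_comp f

theorem definable_of_definableOver {α : Type} {D : Set (α → TwoSorted val)}
    (hD : DefinableOver (twoSortedFamily val α) D) :
    (∅ : Set (TwoSorted val)).Definable valuedFieldLanguage D := by
  obtain ⟨ι, _, f, S, hf, hS, rfl⟩ := hD
  refine (definable_of_valueDefinable (val := val) hS).preimage_map
    (F := fun x i => ofValue val (f i x)) fun i => ?_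
  rcases hf i with ⟨p, hp⟩ | ⟨j, hj⟩ | ⟨j, hj⟩
  · simp only [hp]
    exact twoSortedFun_val (FieldFun.aeval p)
  · simp only [hj]
    exact twoSortedFun_valuePart j
  · simp only [hj]
    exact twoSortedFun_sortCode j

end TwoSortedDefinable

/-! ### Stable embeddedness for families of parameters -/

section Families

variable {𝓛 : FirstOrder.Language.{0, 0}} {M : Type*} [𝓛.Structure M]

/-- The subset `A` is stably embedded uniformly for families of parameters indexed by `ι`. -/
def FamilyEmbedded (𝓛 : FirstOrder.Language.{0, 0}) {M : Type*} [𝓛.Structure M] (A : Set M)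
    (ι : Type*) : Prop :=
  ∀ (α δ : Type) [Finite α] [Finite δ] (X : Set (α ⊕ δ → M)), (∅ : Set M).Definable 𝓛 X →
    ∀ b : ι → δ → M, ∃ (κ : Type) (_ : Finite κ) (Y : Set (α ⊕ κ → M)),
      (∅ : Set M).Definable 𝓛 Y ∧ ∀ i, ∃ a : κ → M, (∀ k, a k ∈ A) ∧
        ∀ x : α → M, (∀ j, x j ∈ A) → (Sum.elim x (b i) ∈ X ↔ Sum.elim x a ∈ Y)

theorem definable_fiber {A : Set M} {α κ : Type} [Finite α] [Finite κ] {Y : Set (α ⊕ κ → M)}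
    (hY : (∅ : Set M).Definable 𝓛 Y) {a : κ → M} (ha : ∀ k, a k ∈ A) :
    A.Definable 𝓛 {x : α → M | Sum.elim x a ∈ Y} := by
  refine (hY.mono (empty_subset A)).preimage_map (F := fun x => Sum.elim x a) fun c => ?_
  rcases c with j | k
  · exact DefinableFun.proj 𝓛
  · exact 𝓛.definableFun_const _ (ha k)

theorem exists_fiber_of_definable {A : Set M} {α : Type} {Y : Set (α → M)}
    (hY : A.Definable 𝓛 Y) : ∃ (k : ℕ) (Z : Set (α ⊕ Fin k → M)) (a : Fin k → M),
      (∅ : Set M).Definable 𝓛 Z ∧ (∀ j, a j ∈ A) ∧ ∀ x, x ∈ Y ↔ Sum.elim x a ∈ Z := by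
  obtain ⟨A₀, hA₀, h⟩ := definable_iff_finitely_definable.1 hY
  obtain ⟨φ, rfl⟩ := definable_iff_exists_formula_sum.1 h
  let e := A₀.equivFin
  refine ⟨A₀.card, {z | (φ.relabel (Sum.elim (fun a => Sum.inr (e a)) Sum.inl :
      (A₀ : Set M) ⊕ α → α ⊕ Fin A₀.card)).Realize z},
    fun j => e.symm j, empty_definable_iff.2 ⟨_, rfl⟩, fun j => hA₀ (e.symm j).2, fun x => ?_⟩
  simp only [mem_ofPred_eq, Formula.realize_relabel]
  rw [iff_iff_eq]
  congr 1
  funext c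
  rcases c with c | c
  · simp
  · rfl

theorem stablyEmbedded_iff_familyEmbedded {A : Set M} :
    StablyEmbedded 𝓛 A ↔ FamilyEmbedded 𝓛 A Unit := by
  constructor
  · intro h α δ _ _ X hX b
    obtain ⟨n, ⟨e⟩⟩ := Finite.exists_equiv_fin α
    obtain ⟨Y, hY, hXY⟩ := h n {x | Sum.elim (x ∘ e) (b ()) ∈ X}
      ((definable_fiber hX fun k => mem_univ (b () k)).preimage_comp e)
    obtain ⟨k, Z, a, hZ, ha, hYZ⟩ := exists_fiber_of_definable hY
    refine ⟨Fin k, inferInstance, _, hZ.preimage_comp (Sum.map e.symm id), fun _ => ⟨a, ha,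
      fun x hx => ?_⟩⟩
    have h1 := Set.ext_iff.1 hXY (x ∘ e.symm)
    simp only [mem_inter_iff, mem_ofPred_eq, Function.comp_apply, hx, implies_true, and_true,
      hYZ] at h1
    rw [Function.comp_assoc, e.symm_comp_self, Function.comp_id] at h1
    rw [show b PUnit.unit = b () from rfl] at *
    rw [h1, mem_preimage, Sum.elim_comp_map, Function.comp_id]
  · intro h n X hX
    obtain ⟨k, Z, b, hZ, -, hXZ⟩ := exists_fiber_of_definable hX
    obtain ⟨κ, _, Y, hY, hYa⟩ := h (Fin n) (Fin k) Z hZ fun _ => b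
    obtain ⟨a, ha, hYa⟩ := hYa ()
    refine ⟨_, definable_fiber hY ha, ?_⟩
    ext x
    simp only [mem_inter_iff, mem_ofPred_eq, and_congr_left_iff]
    intro hx
    rw [hXZ, hYa x hx]

theorem UniformlyStablyEmbedded.familyEmbedded {A : Set M} (h : UniformlyStablyEmbedded 𝓛 A)
    (ι : Type*) : FamilyEmbedded 𝓛 A ι := by
  intro α δ _ _ X hX b
  obtain ⟨n, ⟨e⟩⟩ := Finite.exists_equiv_fin α
  obtain ⟨m, ⟨e'⟩⟩ := Finite.exists_equiv_fin δ
  obtain ⟨φ, rfl⟩ := empty_definable_iff.1 hX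
  obtain ⟨k, χ, hχ⟩ := h n m (φ.relabel (Sum.map e e'))
  refine ⟨Fin k, inferInstance, _,
    (empty_definable_iff.2 ⟨χ, rfl⟩ : (∅ : Set M).Definable 𝓛 _).preimage_comp
      (Sum.map e.symm id), fun i => ?_⟩
  obtain ⟨a, ha, haX⟩ := hχ (b i ∘ e'.symm)
  refine ⟨a, ha, fun x hx => ?_⟩
  have h1 := Set.ext_iff.1 haX (x ∘ e.symm)
  simp only [mem_ofPred_eq, Function.comp_apply, hx, implies_true, true_and,
    Formula.realize_relabel, Sum.elim_comp_map] at h1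
  simp only [Function.comp_assoc, Equiv.symm_comp_self, Function.comp_id] at h1
  simpa only [mem_preimage, Sum.elim_comp_map, Function.comp_id] using! h1

/-- Apply the family version to the identity family of all parameter tuples: the formula is chosen
before the tuple. -/
theorem uniformlyStablyEmbedded_of_familyEmbedded {A : Set M}
    (h : ∀ m, FamilyEmbedded 𝓛 A (Fin m → M)) : UniformlyStablyEmbedded 𝓛 A := by
  intro n m φ
  obtain ⟨κ, _, Y, hY, hYa⟩ := h m (Fin n) (Fin m) _ (empty_definable_iff.2 ⟨φ, rfl⟩) id
  obtain ⟨k, ⟨e⟩⟩ := Finite.exists_equiv_fin κ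
  obtain ⟨χ, rfl⟩ := empty_definable_iff.1 hY
  refine ⟨k, χ.relabel (Sum.map id e), fun b => ?_⟩
  obtain ⟨a, ha, haY⟩ := hYa b
  refine ⟨a ∘ e.symm, fun j => ha _, ?_⟩
  ext x
  simp only [mem_ofPred_eq, and_congr_right_iff]
  intro hx
  simpa [Formula.realize_relabel, Sum.elim_comp_map, Function.comp_assoc] using! haY x hx

end Families

/-! ### Passing from the value group to the value group with infinity -/

section ExtendedGroup

set_option linter.unusedSectionVars false

variable {Γ : Type*} [AddCommGroup Γ] [LinearOrder Γ] [IsOrderedAddMonoid Γ]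

theorem valueDefinable_of_definableOver_coord {α : Type} {D : Set (α → WithTop Γ)}
    (hD : DefinableOver {f | ∃ i, f = fun w : α → WithTop Γ => w i} D) : ValueDefinable D := by
  obtain ⟨ι, _, f, S, hf, hS, rfl⟩ := hD
  choose c hc using hf
  obtain rfl : f = fun i w => w (c i) := funext hc
  exact hS.preimage_comp c

theorem fillTop_untop {α : Type} (w : α → WithTop Γ) :
    fillTop {i | w i = ⊤} (fun i => (w i).untopD 0) = w := by
  ext i
  by_cases h : w i = ⊤
  · rw [fillTop_of_mem h, h]
  · rw [fillTop_of_notMem h]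
    obtain ⟨γ, hγ⟩ := WithTop.ne_top_iff_exists.1 h
    simp [← hγ]

/-- The union of a subset of the value group and `{∞}`. -/
def withInfinity (G : Set Γ) : Set (WithTop Γ) := {w | w = ⊤ ∨ ∃ γ ∈ G, w = γ}

theorem untop_mem_of_mem_withInfinity {G : Set Γ} (h0 : 0 ∈ G) {w : WithTop Γ}
    (hw : w ∈ withInfinity G) : w.untopD 0 ∈ G := by
  rcases hw with rfl | ⟨γ, hγ, rfl⟩
  · simpa using h0
  · simpa using hγ

/-- Uniform embeddedness of a subset of the value group passes to the value group with `∞`. -/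
theorem FamilyEmbedded.withInfinity {G : Set Γ} (h0 : 0 ∈ G) {ι : Type*}
    (H : FamilyEmbedded orderedGroupLanguage G ι) {P R : Type} [Finite P] [Finite R]
    {S : Set (P ⊕ R → WithTop Γ)} (hS : ValueDefinable S) (v : ι → R → WithTop Γ) :
    ∃ (κ : Type) (_ : Finite κ) (S' : Set (P ⊕ κ → WithTop Γ)), ValueDefinable S' ∧
      ∃ a : ι → κ → WithTop Γ, (∀ i k, a i k ∈ _root_.withInfinity G) ∧
        ∀ i u, (∀ j, u j ∈ _root_.withInfinity G) →
          (Sum.elim u (v i) ∈ S ↔ Sum.elim u (a i) ∈ S') := by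
  classical
  -- One application of the hypothesis for each pattern T of infinite coordinates, with ∞ replaced
  -- by 0 in the parameters.
  choose κ hκ Y hY a ha haY using fun T : Set (P ⊕ R) =>
    H P R {g | fillTop T g ∈ S} (definable_fillTop hS T) fun i r => (v i r).untopD 0
  let res : ∀ T, (P ⊕ ((Σ T, κ T) ⊕ R) → WithTop Γ) → P ⊕ κ T → WithTop Γ :=
    fun T w c => w (Sum.map id (fun k => Sum.inl ⟨T, k⟩) c)
  -- The new parameters collect those of all patterns; a second block, with entries ∞ or 0,
  -- remembers which old parameters were infinite, so that `S'` can recognise the pattern uniformly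
  -- in i.
  refine ⟨(Σ T, κ T) ⊕ R, inferInstance,
    {w | ∃ T : Set (P ⊕ R), (∀ j, w (Sum.inl j) = ⊤ ↔ Sum.inl j ∈ T) ∧
      (∀ r, w (Sum.inr (Sum.inr r)) = ⊤ ↔ Sum.inr r ∈ T) ∧
      (fun c => (res T w c).untopD 0) ∈ Y T}, ?_,
    fun i => Sum.elim (fun k => ((a k.1 i k.2 : Γ) : WithTop Γ))
      (fun r => if v i r = ⊤ then ⊤ else 0), ?_, fun i u hu => ?_⟩
  · refine valueDefinable_of_definableOver_coord (.exists fun T => .and (.forall fun j => .iff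
      (.eq_top (.of_mem ⟨_, rfl⟩)) (.const _)) (.and (.forall fun r => .iff
      (.eq_top (.of_mem ⟨_, rfl⟩)) (.const _)) ?_))
    exact .subst (h := fun c w => res T w c) (fun c => DefinableFunOver.of_mem
      (show (fun w => res T w c) ∈ {f | ∃ i, f = fun w : P ⊕ ((Σ T, κ T) ⊕ R) → WithTop Γ => w i} from
        ⟨_, rfl⟩)) (valueDefinable_of_definable (hY T))
  · rintro i (k | r)
    · exact Or.inr ⟨_, ha _ _ _, rfl⟩
    · by_cases h : v i r = ⊤
      · simp [h, _root_.withInfinity]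
      · exact Or.inr ⟨0, h0, by simp [h]⟩
  · let T₀ : Set (P ⊕ R) := {c | Sum.elim u (v i) c = ⊤}
    have h1 : Sum.elim u (v i) ∈ S ↔
        Sum.elim (fun j => (u j).untopD 0) (fun r => (v i r).untopD 0) ∈ {g | fillTop T₀ g ∈ S} := by
      rw [mem_ofPred_eq]
      conv_lhs => rw [← fillTop_untop (Sum.elim u (v i))]
      rw [show (fun c => (Sum.elim u (v i) c).untopD 0) =
        Sum.elim (fun j => (u j).untopD 0) (fun r => (v i r).untopD 0) by
          ext (c | c) <;> rfl]
    rw [h1, haY T₀ i _ fun j => untop_mem_of_mem_withInfinity h0 (hu j)]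
    have h2 : ∀ T, (fun c => (res T (Sum.elim u (Sum.elim
        (fun k : Σ T, κ T => ((a k.1 i k.2 : Γ) : WithTop Γ))
        (fun r => if v i r = ⊤ then ⊤ else 0))) c).untopD 0) =
        Sum.elim (fun j => (u j).untopD 0) (a T i) := by
      intro T
      ext (c | c)
      · rfl
      · simp [res]
    simp only [mem_ofPred_eq, h2, Sum.elim_inl, Sum.elim_inr]
    have h3 : ∀ r, (if v i r = ⊤ then (⊤ : WithTop Γ) else 0) = ⊤ ↔ v i r = ⊤ := by
      intro r
      by_cases h : v i r = ⊤ <;> simp [h]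
    simp only [h3]
    constructor
    · exact fun h => ⟨T₀, fun j => Iff.rfl, fun r => Iff.rfl, h⟩
    · rintro ⟨T, hT, hT', h⟩
      obtain rfl : T = T₀ := by
        ext (c | c)
        · exact (hT c).symm
        · exact (hT' c).symm
      exact h

end ExtendedGroup

/-! ### Separated pairs and transfer between K and its value group -/

section SeparatedPairs

set_option linter.unusedSectionVars false

open TwoSorted

variable {L : Type*} [Field L] {Γ : Type*} [AddCommGroup Γ] [LinearOrder Γ]
  [IsOrderedAddMonoid Γ] {val : AddValuation L (WithTop Γ)} {K : Subfield L}

theorem zero_mem_valueGroupOf : (0 : Γ) ∈ valueGroupOf val K :=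
  ⟨1, K.one_mem, by simp⟩

theorem val_mem_withInfinity {x : L} (hx : x ∈ K) :
    val x ∈ withInfinity (valueGroupOf val K) := by
  by_cases h : val x = ⊤
  · exact Or.inl h
  · obtain ⟨γ, hγ⟩ := WithTop.ne_top_iff_exists.1 h
    exact Or.inr ⟨γ, ⟨x, hx, hγ.symm⟩, hγ.symm⟩

theorem exists_val_eq_of_mem_withInfinity {w : WithTop Γ}
    (hw : w ∈ withInfinity (valueGroupOf val K)) : ∃ x ∈ K, val x = w := by
  rcases hw with rfl | ⟨γ, ⟨x, hx, hγ⟩, rfl⟩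
  · exact ⟨0, K.zero_mem, val.map_zero⟩
  · exact ⟨x, hx, hγ⟩

theorem zero_mem_withInfinity : (0 : WithTop Γ) ∈ withInfinity (valueGroupOf val K) :=
  Or.inr ⟨0, zero_mem_valueGroupOf, rfl⟩

theorem ofField_mem_valuedSubfield {x : L} (hx : x ∈ K) :
    ofField val x ∈ valuedSubfield val K := Or.inl ⟨x, hx, rfl⟩

theorem ofValue_mem_valuedSubfield {w : WithTop Γ}
    (hw : w ∈ withInfinity (valueGroupOf val K)) : ofValue val w ∈ valuedSubfield val K := by
  obtain ⟨x, hx, rfl⟩ := exists_val_eq_of_mem_withInfinity hw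
  exact Or.inr ⟨x, hx, rfl⟩

theorem fieldPart_mem {x : TwoSorted val} (hx : x ∈ valuedSubfield val K) :
    fieldPart x ∈ K := by
  rcases hx with ⟨a, ha, rfl⟩ | ⟨a, ha, rfl⟩
  · exact ha
  · exact K.zero_mem

theorem valuePart_mem {x : TwoSorted val} (hx : x ∈ valuedSubfield val K) :
    valuePart x ∈ withInfinity (valueGroupOf val K) := by
  rcases hx with ⟨a, ha, rfl⟩ | ⟨a, ha, rfl⟩
  · exact zero_mem_withInfinity
  · exact val_mem_withInfinity ha

theorem sortCode_mem (x : TwoSorted val) :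
    sortCode x ∈ withInfinity (valueGroupOf val K) := by
  rcases x.cases with ⟨a, rfl⟩ | ⟨a, rfl⟩
  · exact zero_mem_withInfinity
  · exact Or.inl rfl

theorem aeval_mem {α : Type} (p : MvPolynomial α ℤ) {y : α → L} (hy : ∀ i, y i ∈ K) :
    MvPolynomial.aeval y p ∈ K := by
  induction p using MvPolynomial.induction_on with
  | C a => simp
  | add p q hp hq => simpa using K.add_mem hp hq
  | mul_X p i hp => simpa using K.mul_mem hp (hy i)

/-- Finite families in a separated pair can be expanded along a separated family of the same
size. -/
theorem IsSeparatedPair.exists_expansion (hsep : IsSeparatedPair val K) {I : Type} [Fintype I]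
    (v : I → L) : ∃ (e : I → L) (k : I → I → L), (∀ i h, k i h ∈ K) ∧
      (∀ i, v i = ∑ h, k i h * e h) ∧ ∀ c : I → L, (∀ h, c h ∈ K) →
        val (∑ h, c h * e h) = Finset.univ.inf fun h => val (c h) + val (e h) := by
  classical
  let V : Submodule K L := Submodule.span K (range v)
  have hV : FiniteDimensional K V := FiniteDimensional.span_of_finite K (finite_range v)
  obtain ⟨n, b, hb⟩ := hsep V hV
  have hn : n ≤ Fintype.card I := by
    have h1 := Module.finrank_eq_card_basis b
    rw [Fintype.card_fin] at h1
    rw [← h1]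
    exact finrank_range_le_card v
  -- The separated basis is padded by zeros up to the index set I. The number of coefficients is
  -- then independent of `v`, as uniformity requires, and the padding adds only ∞ to the minimum.
  obtain ⟨ε⟩ : Nonempty (Fin n ↪ I) := Function.Embedding.nonempty_of_card_le (by simpa using hn)
  let e : I → L := Function.extend ε (fun j => (b j : L)) 0
  have he : ∀ j, e (ε j) = b j := fun j => ε.injective.extend_apply _ _ _
  have he' : ∀ h, h ∉ range ε → e h = 0 := fun h hh => Function.extend_apply' _ _ _ hh
  have hsum : ∀ c : I → L, ∑ h, c h * e h = ∑ j, c (ε j) * b j := by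
    intro c
    refine (Fintype.sum_of_injective ε ε.injective _ _ (fun h hh => ?_) fun j => ?_).symm
    · rw [he' h hh, mul_zero]
    · rw [he]
  let k : I → I → L := fun i => Function.extend ε
    (fun j => ((b.repr ⟨v i, Submodule.subset_span ⟨i, rfl⟩⟩ j : K) : L)) 0
  have hk : ∀ i j, k i (ε j) = ((b.repr ⟨v i, Submodule.subset_span ⟨i, rfl⟩⟩ j : K) : L) :=
    fun i j => ε.injective.extend_apply _ _ _
  refine ⟨e, k, fun i h => ?_, fun i => ?_, fun c hc => ?_⟩
  · by_cases hh : h ∈ range ε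
    · obtain ⟨j, rfl⟩ := hh
      rw [hk]
      exact Subtype.property _
    · rw [show k i h = 0 from Function.extend_apply' _ _ _ hh]
      exact K.zero_mem
  · rw [hsum]
    have h1 := congrArg (Subtype.val : V → L)
      (b.sum_repr ⟨v i, Submodule.subset_span ⟨i, rfl⟩⟩)
    rw [← show ((⟨v i, Submodule.subset_span ⟨i, rfl⟩⟩ : V) : L) = v i from rfl, ← h1]
    simp only [hk, AddSubmonoidClass.coe_finsetSum, SetLike.val_smul]
    rfl
  · rw [hsum, hb fun j => ⟨c (ε j), hc _⟩]
    refine le_antisymm (Finset.le_inf fun h _ => ?_) (Finset.le_inf fun j _ => ?_)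
    · by_cases hh : h ∈ range ε
      · obtain ⟨j, rfl⟩ := hh
        refine Finset.inf_le_of_le (Finset.mem_univ j) ?_
        rw [he, val.map_mul]
      · simp [he' h hh]
    · refine Finset.inf_le_of_le (Finset.mem_univ (ε j)) ?_
      rw [he, ← val.map_mul]

/-- On tuples from a separated subfield, a basic function with parameters is a minimum of sums of
definable functions with parameters from the subfield and constants. -/
theorem IsSeparatedPair.exists_normal_form (hsep : IsSeparatedPair val K) {ι : Type*} {α δ : Type}
    [Finite α] [Finite δ] (b : ι → δ → TwoSorted val)
    {f : (α ⊕ δ → TwoSorted val) → WithTop Γ} (hf : f ∈ twoSortedFamily val (α ⊕ δ)) :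
    ∃ (H κ : Type) (_ : Fintype H) (_ : Finite κ)
      (A : H → (α ⊕ κ → TwoSorted val) → WithTop Γ) (k : ι → κ → TwoSorted val)
      (B : ι → H → WithTop Γ),
      (∀ h, DefinableFunOver (twoSortedFamily val (α ⊕ κ)) (A h)) ∧
      (∀ i j, k i j ∈ valuedSubfield val K) ∧
      ∀ i x, (∀ j, x j ∈ valuedSubfield val K) →
        (∀ h, A h (Sum.elim x (k i)) ∈ withInfinity (valueGroupOf val K)) ∧
        f (Sum.elim x (b i)) = Finset.univ.inf fun h => A h (Sum.elim x (k i)) + B i h := by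
  classical
  have := Fintype.ofFinite α
  have := Fintype.ofFinite δ
  rcases hf with ⟨p, rfl⟩ | ⟨j | j, rfl⟩ | ⟨j | j, rfl⟩
  · choose e k hkK hk hval using fun i => hsep.exists_expansion
      (fun m : p.support => ∏ j : δ, fieldPart (b i j) ^ m.1 (Sum.inr j))
    -- The coefficient of e_h in p(x, b) after the parameter monomials are expanded; the expansion
    -- coefficients k become new variables.
    let r : p.support → MvPolynomial (α ⊕ (p.support × p.support)) ℤ := fun h =>
      ∑ m : p.support, MvPolynomial.C (MvPolynomial.coeff m.1 p) * MvPolynomial.X (Sum.inr (m, h)) *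
        ∏ j : α, MvPolynomial.X (Sum.inl j) ^ m.1 (Sum.inl j)
    have hr : ∀ i (x : α → TwoSorted val) h, MvPolynomial.aeval (fun c => fieldPart
        (Sum.elim x (fun j : p.support × p.support => ofField val (k i j.1 j.2)) c)) (r h) =
        ∑ m : p.support, ((MvPolynomial.coeff m.1 p : ℤ) : L) * k i m h *
          ∏ j : α, fieldPart (x j) ^ m.1 (Sum.inl j) := by
      intro i x h
      simp [r]
    refine ⟨p.support, p.support × p.support, inferInstance, inferInstance,
      fun h z => val (MvPolynomial.aeval (fun c => fieldPart (z c)) (r h)),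
      fun i j => ofField val (k i j.1 j.2), fun i h => val (e i h),
      fun h => definableFunOver_aeval _, fun i j => ofField_mem_valuedSubfield (hkK _ _ _),
      fun i x hx => ?_⟩
    have hmem : ∀ h, MvPolynomial.aeval (fun c => fieldPart
        (Sum.elim x (fun j : p.support × p.support => ofField val (k i j.1 j.2)) c)) (r h) ∈ K := by
      refine fun h => aeval_mem _ ?_
      rintro (j | j)
      · exact fieldPart_mem (hx j)
      · exact hkK _ _ _
    refine ⟨fun h => val_mem_withInfinity (hmem h), ?_⟩
    rw [← hval i _ hmem]
    simp only [hr]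
    rw [MvPolynomial.aeval_def, MvPolynomial.eval₂_eq', ← Finset.sum_coe_sort]
    simp only [Fintype.prod_sum_type, Sum.elim_inl, Sum.elim_inr, hk, Finset.sum_mul,
      Finset.mul_sum]
    rw [Finset.sum_comm]
    congr 1
    refine Finset.sum_congr rfl ?_
    intro h _
    refine Finset.sum_congr rfl ?_
    intro m _
    simp only [algebraMap_int_eq, eq_intCast]
    ring
  · exact ⟨Unit, Empty, inferInstance, inferInstance, fun _ z => valuePart (z (Sum.inl j)),
      fun _ c => c.elim, fun _ _ => 0, fun _ => definableFunOver_valuePart _, fun _ c => c.elim,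
      fun i x hx => ⟨fun _ => valuePart_mem (hx j), by simp⟩⟩
  -- The value of a parameter may lie outside Γ(K), so it goes into the constant term `B`.
  · exact ⟨Unit, Empty, inferInstance, inferInstance, fun _ _ => 0,
      fun _ c => c.elim, fun i _ => valuePart (b i j), fun _ => .zero, fun _ c => c.elim,
      fun i x hx => ⟨fun _ => zero_mem_withInfinity, by simp⟩⟩
  · exact ⟨Unit, Empty, inferInstance, inferInstance, fun _ z => sortCode (z (Sum.inl j)),
      fun _ c => c.elim, fun _ _ => 0, fun _ => definableFunOver_sortCode _, fun _ c => c.elim,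
      fun i x hx => ⟨fun _ => sortCode_mem _, by simp⟩⟩
  · exact ⟨Unit, Empty, inferInstance, inferInstance, fun _ _ => 0,
      fun _ c => c.elim, fun i _ => sortCode (b i j), fun _ => .zero, fun _ c => c.elim,
      fun i x hx => ⟨fun _ => zero_mem_withInfinity, by simp⟩⟩

/-- In normal form, x enters through values `A` in Γ(K) ∪ {∞} and the remaining outside parameters
through values `B`. Embeddedness of Γ(K) trades `B` for parameters in Γ(K) ∪ {∞}, and the condition
is read back as a formula over K. -/
theorem FamilyEmbedded.valuedSubfield [IsAlgClosed L] (hval : Function.Surjective val)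
    (hsep : IsSeparatedPair val K) {ι : Type*}
    (H : FamilyEmbedded orderedGroupLanguage (valueGroupOf val K) ι) :
    FamilyEmbedded valuedFieldLanguage (_root_.valuedSubfield val K) ι := by
  intro α δ _ _ X hX b
  obtain ⟨ι', _, f, S, hf, hS, rfl⟩ := definableOver_of_definable hval hX
  choose J κ hJ hκ A k B hA hk hx using fun c => hsep.exists_normal_form b (hf c)
  let P : Type := Σ c, J c
  let S₁ : Set (P ⊕ P → WithTop Γ) :=
    {w | (fun c => Finset.univ.inf fun h : J c => w (Sum.inl ⟨c, h⟩) + w (Sum.inr ⟨c, h⟩)) ∈ S}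
  have hS₁ : ValueDefinable S₁ := hS.preimage_map
    (F := fun (w : P ⊕ P → WithTop Γ) c => Finset.univ.inf fun h : J c =>
      w (Sum.inl ⟨c, h⟩) + w (Sum.inr ⟨c, h⟩))
    fun c => ValueDefinableFun.finset_inf _ fun h =>
      (valueDefinableFun_proj _).add (valueDefinableFun_proj _)
  obtain ⟨κ', _, S', hS', a, ha, haS⟩ := H.withInfinity zero_mem_valueGroupOf hS₁
    fun i (c : P) => B c.1 i c.2
  let g : P ⊕ κ' → (α ⊕ ((Σ c, κ c) ⊕ κ') → TwoSorted val) → WithTop Γ :=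
    Sum.elim (fun c (z : α ⊕ ((Σ c, κ c) ⊕ κ') → TwoSorted val) => A c.1 c.2 fun d => z (Sum.map id (fun j => Sum.inl ⟨c.1, j⟩) d))
      fun j z => valuePart (z (Sum.inr (Sum.inr j)))
  have hg : ∀ c, DefinableFunOver (twoSortedFamily val _) (g c) := by
    rintro (c | j)
    · refine (hA c.1 c.2).trans (k := fun (z : α ⊕ ((Σ c, κ c) ⊕ κ') → TwoSorted val) d =>
        z (Sum.map id (fun j => Sum.inl ⟨c.1, j⟩) d)) ?_
      rintro _ (⟨p, rfl⟩ | ⟨i, rfl⟩ | ⟨i, rfl⟩)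
      · convert! definableFunOver_aeval (val := val) (MvPolynomial.rename
          (Sum.map id (fun j => Sum.inl ⟨c.1, j⟩) : α ⊕ κ c.1 → α ⊕ ((Σ c, κ c) ⊕ κ')) p)
          using 3 with z
        rw [MvPolynomial.aeval_rename]
        rfl
      · exact definableFunOver_valuePart _
      · exact definableFunOver_sortCode _
    · exact definableFunOver_valuePart _
  refine ⟨(Σ c, κ c) ⊕ κ', inferInstance, _, definable_of_definableOver (.subst hg hS'),
    fun i => ⟨Sum.elim (fun j => k j.1 i j.2) fun j => ofValue val (a i j), ?_, fun x hxA => ?_⟩⟩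
  · rintro (j | j)
    · exact hk _ _ _
    · exact ofValue_mem_valuedSubfield (ha i j)
  · have h1 := haS i (fun c : P => A c.1 c.2 (Sum.elim x (k c.1 i)))
      fun c => (hx c.1 i x hxA).1 c.2
    have h2 : (Sum.elim x (b i) ∈ {e | (fun c => f c e) ∈ S}) ↔
        Sum.elim (fun c : P => A c.1 c.2 (Sum.elim x (k c.1 i)))
          (fun c : P => B c.1 i c.2) ∈ S₁ := by
      simp only [mem_ofPred_eq, S₁, Sum.elim_inl, Sum.elim_inr]
      rw [show (fun c => f c (Sum.elim x (b i))) = _ from funext fun c => (hx c i x hxA).2]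
    rw [h2, h1, mem_ofPred_eq, iff_iff_eq]
    congr 1
    funext c
    rcases c with c | j
    · simp only [Sum.elim_inl, g]
      congr 1
      funext d
      rcases d with d | d <;> rfl
    · rfl

/-- On tuples of values all field parts vanish, so by relative quantifier elimination a formula over
K sees only the coordinates and constants from Γ(K) ∪ {∞}. -/
theorem StablyEmbedded.valueGroupOf [IsAlgClosed L] (hval : Function.Surjective val)
    (H : StablyEmbedded valuedFieldLanguage (valuedSubfield val K)) :
    StablyEmbedded orderedGroupLanguage (_root_.valueGroupOf val K) := by
  classical
  rw [stablyEmbedded_iff_familyEmbedded] at H ⊢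
  intro α δ _ _ X hX b
  obtain ⟨κ, _, Y, hY, hYa⟩ := H α δ _
    (definable_of_valueDefinable (val := val) (valueDefinable_of_definable hX))
    fun i j => ofValue val (b i j)
  obtain ⟨a, ha, haY⟩ := hYa ()
  obtain ⟨C, _, f, S, hf, hS, rfl⟩ := definableOver_of_definable hval hY
  let x : (α → Γ) → α → TwoSorted val := fun g j => ofValue val (g j)
  have hsplit : ∀ c, ∃ (s : α ⊕ C) (w : WithTop Γ), w ∈ withInfinity (_root_.valueGroupOf val K) ∧
      s = s.elim Sum.inl (fun _ => Sum.inr c) ∧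
      ∀ g, f c (Sum.elim (x g) a) = s.elim (fun j => (g j : WithTop Γ)) fun _ => w := by
    intro c
    rcases hf c with ⟨p, hp⟩ | ⟨j | j, hj⟩ | ⟨j | j, hj⟩
    · refine ⟨Sum.inr c, val (MvPolynomial.aeval (Sum.elim 0 fun j => fieldPart (a j)) p),
        val_mem_withInfinity (aeval_mem _ ?_), rfl, fun g => ?_⟩
      · rintro (j | j)
        · exact K.zero_mem
        · exact fieldPart_mem (ha j)
      · rw [hp]
        simp only [Sum.elim_inr]
        congr 3
        funext d
        rcases d with d | d <;> rfl
    · exact ⟨Sum.inl j, 0, zero_mem_withInfinity, rfl, fun g => by rw [hj]; rfl⟩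
    · exact ⟨Sum.inr c, _, valuePart_mem (ha j), rfl, fun g => by rw [hj]; rfl⟩
    · exact ⟨Sum.inr c, ⊤, Or.inl rfl, rfl, fun g => by rw [hj]; rfl⟩
    · exact ⟨Sum.inr c, _, sortCode_mem (a j), rfl, fun g => by rw [hj]; rfl⟩
  choose s w hw hs hfs using hsplit
  -- Infinite constants cannot be parameters from the group and are built into the formula through
  -- T. This makes the formula depend on `a`, which is harmless for a single parameter tuple.
  let T : Set (α ⊕ C) := {d | ∃ c, d = Sum.inr c ∧ w c = ⊤}
  refine ⟨C, inferInstance, _, definable_fillTop (hS.preimage_comp s) T, fun _ =>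
    ⟨fun c => (w c).untopD 0, fun c => untop_mem_of_mem_withInfinity zero_mem_valueGroupOf (hw c),
    fun g hg => ?_⟩⟩
  have h1 := haY (x g) fun j => ofValue_mem_valuedSubfield (Or.inr ⟨_, hg j, rfl⟩)
  have h2 : (fun i => (valuePart (Sum.elim (x g) (fun j => ofValue val (b () j)) i)).untopD 0) =
      Sum.elim g (b ()) := by
    funext d
    rcases d with d | d <;> rfl
  simp only [mem_ofPred_eq, h2] at h1
  refine h1.trans ?_
  rw [mem_ofPred_eq, mem_preimage, iff_iff_eq]
  congr 1
  funext c
  rw [hfs, Function.comp_apply]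
  have hsc := hs c
  rcases hc : s c with j | d
  · rw [fillTop_of_notMem (by simp [T])]
    rfl
  · rw [hc] at hsc
    obtain rfl : d = c := by simpa using hsc
    by_cases h : w d = ⊤
    · rw [fillTop_of_mem (show Sum.inr d ∈ T from ⟨d, rfl, h⟩)]
      exact h
    · rw [fillTop_of_notMem (by simpa [T] using h)]
      obtain ⟨γ, hγ⟩ := WithTop.ne_top_iff_exists.1 h
      simp [← hγ]

end SeparatedPairs

theorem mainTheorem11 {L : Type*} [Field L] [IsAlgClosed L]
    {Γ : Type*} [AddCommGroup Γ] [LinearOrder Γ] [IsOrderedAddMonoid Γ]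
    (val : AddValuation L (WithTop Γ)) (hval : Function.Surjective val)
    (K : Subfield L) (hsep : IsSeparatedPair val K) :
    (StablyEmbedded valuedFieldLanguage (valuedSubfield val K) ↔
      StablyEmbedded orderedGroupLanguage (valueGroupOf val K)) ∧
    (UniformlyStablyEmbedded orderedGroupLanguage (valueGroupOf val K) →
      UniformlyStablyEmbedded valuedFieldLanguage (valuedSubfield val K)) := by
  refine ⟨⟨fun h => h.valueGroupOf hval, fun h => ?_⟩, fun h => ?_⟩
  · rw [stablyEmbedded_iff_familyEmbedded] at h ⊢
    exact h.valuedSubfield hval hsep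
  · exact uniformlyStablyEmbedded_of_familyEmbedded fun m =>
      (h.familyEmbedded _).valuedSubfield hval hsep
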